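/- Let $\phi_a<\phi_b$ with $\phi_b-\phi_a\le\pi$, put $\phi_m=(\phi_a+\phi_b)/2$, and let $V:(\phi_a,\phi_b)\to\mathbb{R}$ satisfy: (A.1) $V(\phi)=\dfrac{\beta_1}{\sin(\phi_b-\phi)}+\dfrac{\beta_2}{\sin(\phi-\phi_a)}+\widehat V(\phi)$ with constants $\beta_1>0$, $\beta_2\ge 0$, where $\beta_2=0$ if and only if $\phi_b-\phi_a=\pi$, and with $\widehat V>0$ bounded and of class $C^3$ on $(\phi_a,\phi_b)$; moreover the critical points of $V$ are non-degenerate. (A.2) $V$ is symmetric with respect to $\phi_m$. (A.3) $V$ has exactly three critical points in $(\phi_a,\phi_b)$, namely $\phi_L<\phi_m<\phi_R$. Put $f(\phi)=\sin(\phi-\phi_a)\sin(\phi_b-\phi)$ if $\phi_b-\phi_a<\pi$ and $f(\phi)=\sin(\phi_b-\phi)$ if $\phi_b-\phi_a=\pi$; let $W=fV$ and $F=f/\sqrt W$. Consider (at energy $h=-1$) the system $$\frac{dr}{ds}=rvF(\phi),\qquad \frac{dv}{ds}=F(\phi)\Bigl(2hr-\frac{v^2}{2}\Bigr)+\sqrt{W(\phi)},\qquad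 \frac{d\phi}{ds}=w,$$ $$\frac{dw}{ds}=-\frac{vw}{2}F(\phi)+\frac{W'(\phi)}{W(\phi)}\Bigl(f(\phi)-\frac{w^2}{2}\Bigr)+f'(\phi)\Bigl(1+\frac{f(\phi)}{W(\phi)}(2hr-v^2)\Bigr)$$ restricted to the collision manifold $\Bigl\{r=0,\ \dfrac{w^2}{2f(\phi)}+\dfrac{f(\phi)}{W(\phi)}\dfrac{v^2}{2}=1\Bigr\}$. Let $\gamma'$ be the branch, initially with $w\ge 0$, of the unstable manifold in the collision manifold of the equilibrium $L'_-=(r,v,\phi,w)=(0,-\sqrt{2V(\phi_L)},\phi_L,0)$, that is, the orbit other than $L'_-$ itself that tends to $L'_-$ as $s\to-\infty$ and has $w\ge 0$ for all $s$ near $-\infty$. Let $v_3$ be the $v$-coordinate of the first intersection of $\gamma'$ with $\{\phi=\phi_m\}$. If $$V(\phi_R)>\sin^2\Bigl(\frac{\phi_R-\phi_m}{2}\Bigr)\,V(\phi_m),$$ then $v_3$ is well-defined (the branch $\gamma'$ exists, reaches $\{\phi=\phi_m\}$ before any partial collision, and the value $v_3$ so obtained is unique), and $v_3<0$. -/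

import Mathlib

open Set Filter Topology

noncomputable section

namespace Devaney

/-- The standing assumptions on the shape potential `V` on `(φa, φb)`, whose critical points are
`φL < (φa + φb) / 2 < φR`. Only the values of `V` on the open interval matter. -/
structure IsShapePotential (φa φb φL φR : ℝ) (V : ℝ → ℝ) : Prop where
  lt : φa < φb
  le_pi : φb - φa ≤ Real.pi
  /-- The two partial-collision poles and the regular part. -/
  form : ∃ (β₁ β₂ : ℝ) (Vhat : ℝ → ℝ), 0 < β₁ ∧ 0 ≤ β₂ ∧ (β₂ = 0 ↔ φb - φa = Real.pi) ∧
    ContDiffOn ℝ 3 Vhat (Ioo φa φb) ∧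
    (∀ φ ∈ Ioo φa φb, 0 < Vhat φ) ∧
    (∃ M, ∀ φ ∈ Ioo φa φb, Vhat φ ≤ M) ∧
    ∀ φ ∈ Ioo φa φb,
      V φ = β₁ / Real.sin (φb - φ) + β₂ / Real.sin (φ - φa) + Vhat φ
  /-- Critical points are non-degenerate. -/
  nondegenerate : ∀ φ ∈ Ioo φa φb, deriv V φ = 0 → deriv (deriv V) φ ≠ 0
  /-- Symmetry with respect to the midpoint of the interval. -/
  symmetric : ∀ φ ∈ Ioo φa φb, V (φa + φb - φ) = V φ
  /-- There are exactly three critical points. -/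
  critical : {φ | φ ∈ Ioo φa φb ∧ deriv V φ = 0} = {φL, (φa + φb) / 2, φR}
  left_lt : φL < (φa + φb) / 2
  lt_right : (φa + φb) / 2 < φR

/-- The regularizing factor `f`. -/
def f (φa φb φ : ℝ) : ℝ :=
  if φb - φa < Real.pi then Real.sin (φ - φa) * Real.sin (φb - φ) else Real.sin (φb - φ)

/-- `W = f V`. -/
def W (φa φb : ℝ) (V : ℝ → ℝ) (φ : ℝ) : ℝ := f φa φb φ * V φ

/-- `F = f / √W`. -/
def F (φa φb : ℝ) (V : ℝ → ℝ) (φ : ℝ) : ℝ := f φa φb φ / Real.sqrt (W φa φb V φ)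

/-- A state `(r, v, φ, w)`: size, size velocity, shape, shape velocity. -/
abbrev State : Type := ℝ × ℝ × ℝ × ℝ

/-- The regularized equations of motion at energy `h`, as a vector field on the states. -/
def field (φa φb : ℝ) (V : ℝ → ℝ) (h : ℝ) : State → State
  | (r, v, φ, w) =>
    ( r * v * F φa φb V φ,
      F φa φb V φ * (2 * h * r - v ^ 2 / 2) + Real.sqrt (W φa φb V φ),
      w,
      -(v * w / 2) * F φa φb V φ
        + deriv (W φa φb V) φ / W φa φb V φ * (f φa φb φ - w ^ 2 / 2)
        + deriv (f φa φb) φ * (1 + f φa φb φ / W φa φb V φ * (2 * h * r - v ^ 2)) )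

/-- The collision manifold over the open interval `(φa, φb)`, that is, away from partial
collisions. (The part of the branch `γ'` considered below does not meet partial collisions.) -/
def collisionManifold (φa φb : ℝ) (V : ℝ → ℝ) : Set State :=
  {x | match x with
    | (r, v, φ, w) => r = 0 ∧ φ ∈ Ioo φa φb ∧
        w ^ 2 / (2 * f φa φb φ) + f φa φb φ / W φa φb V φ * (v ^ 2 / 2) = 1}

/-- The lower equilibrium `L'₋ = (0, -√(2 V(φL)), φL, 0)`. -/
def lowerLagrange (φL : ℝ) (V : ℝ → ℝ) : State := (0, -Real.sqrt (2 * V φL), φL, 0)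

/-- `γ`, restricted to `(-∞, s₁]`, is a parametrized initial arc of the branch `γ'`: an orbit
(at energy `-1`) in the collision manifold, in the unstable manifold of `L'₋` (it tends to `L'₋`
as `s → -∞`), distinct from the equilibrium itself, and initially with `w ≥ 0`. -/
structure IsGammaPrimeArc (φa φb φL : ℝ) (V : ℝ → ℝ) (γ : ℝ → State) (s₁ : ℝ) : Prop where
  solution : ∀ s ∈ Iic s₁, HasDerivWithinAt γ (field φa φb V (-1) (γ s)) (Iic s₁) s
  mem_collision : ∀ s ∈ Iic s₁, γ s ∈ collisionManifold φa φb V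
  tendsto : Tendsto γ atBot (𝓝 (lowerLagrange φL V))
  ne_equilibrium : ∀ s ∈ Iic s₁, γ s ≠ lowerLagrange φL V
  initially : ∀ᶠ s in atBot, 0 ≤ (γ s).2.2.2

/-- `v₃` is the `v`-coordinate of the (first) intersection of the branch `γ'` with the plane
`φ = φm`, where `φm = (φa + φb) / 2`. -/
def IsV3 (φa φb φL : ℝ) (V : ℝ → ℝ) (v₃ : ℝ) : Prop :=
  ∃ (γ : ℝ → State) (s₁ : ℝ), IsGammaPrimeArc φa φb φL V γ s₁ ∧
    (∀ s < s₁, (γ s).2.2.1 ≠ (φa + φb) / 2) ∧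
    (γ s₁).2.2.1 = (φa + φb) / 2 ∧ (γ s₁).2.1 = v₃

end Devaney

end

namespace Devaney

/-! With r = 0 the energy drops out. The scaled velocity p = w/F turns the manifold into p² + v² =
2V(φ) and the flow into φ' = Fp, v' = Fp²/2, p' = F(V' - vp/2). While p > 0 the angle φ serves as
time: dv/dφ = p/2, dp/dφ = V'/p - v/2.

Sign of v: for constant V the vector (p, v) would rotate at rate 1/2 in φ. On [φL, φm] the potential
increases, and comparison with a rotation at a rate κ slightly above 1/2 gives v² ≥ 2V(φm) cos²(α +
κ(φ - φL)), where cos² α = V(φL)/V(φm). Since V(φR) = V(φL) and φR - φm = φm - φL by symmetry, the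
hypothesis says exactly that α + (φm - φL)/2 < π/2. So v stays negative up to φm (`exists_profile`).

Existence and uniqueness: the equation for p is singular at φL, where p → 0. With x = φ - φL, p = x
y(x) and V' = x b(x) it becomes (xy)' = b/y - v/2, where v = -√(2V - p²). Its right side is
nonincreasing in y. This monotonicity yields a solution by contraction (`exists_singular_ode`) and
forces every orbit of the branch onto it (`IsGammaPrimeArc.eq_profile`). -/

/-! ### A singular first-order equation. -/

/-- The weight uⁿ has integral 1/(n+1), so an n-Lipschitz G gives a contraction of factor n/(n+1) on
bounded continuous functions. -/
theorem exists_continuous_eq_integral {n : ℕ} {G : ℝ → ℝ → ℝ}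
    (hG : Continuous (Function.uncurry G)) {M : ℝ} (hM : ∀ x z, |G x z| ≤ M)
    (hlip : ∀ x z₁ z₂, |G x z₁ - G x z₂| ≤ n * |z₁ - z₂|) :
    ∃ y : ℝ → ℝ, Continuous y ∧ ∀ x, y x = ∫ u in (0 : ℝ)..1, u ^ n * G (x * u) (y (x * u)) := by
  have hcont : ∀ y : BoundedContinuousFunction ℝ ℝ,
      Continuous (Function.uncurry fun x u : ℝ => u ^ n * G (x * u) (y (x * u))) := by
    intro y
    have : Continuous fun q : ℝ × ℝ => Function.uncurry G (q.1 * q.2, y (q.1 * q.2)) := by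
      fun_prop
    exact (continuous_snd.pow n).mul this
  have hint : ∀ (y : BoundedContinuousFunction ℝ ℝ) (x : ℝ),
      IntervalIntegrable (fun u : ℝ => u ^ n * G (x * u) (y (x * u))) MeasureTheory.volume 0 1 :=
    fun y x => ((hcont y).comp (by fun_prop : Continuous fun u : ℝ => (x, u))).intervalIntegrable _ _
  have hcontT : ∀ y : BoundedContinuousFunction ℝ ℝ,
      Continuous fun x : ℝ => ∫ u in (0 : ℝ)..1, u ^ n * G (x * u) (y (x * u)) := fun y =>
    intervalIntegral.continuous_parametric_intervalIntegral_of_continuous' (hcont y) 0 1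
  have hpow : ∀ C : ℝ, ∫ u in (0 : ℝ)..1, u ^ n * C = C / (n + 1) := by
    intro C
    rw [intervalIntegral.integral_mul_const, integral_pow]
    simp
    ring
  have hbound : ∀ (g : ℝ → ℝ) (C : ℝ), (∀ u, |g u| ≤ C) →
      ‖∫ u in (0 : ℝ)..1, u ^ n * g u‖ ≤ C / (n + 1) := by
    intro g C hg
    rw [← hpow C]
    refine intervalIntegral.norm_integral_le_of_norm_le zero_le_one ?_
      ((by fun_prop : Continuous fun u : ℝ => u ^ n * C).intervalIntegrable _ _)
    filter_upwards with u hu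
    rw [Real.norm_eq_abs, abs_mul, abs_of_nonneg (pow_nonneg hu.1.le n)]
    exact mul_le_mul_of_nonneg_left (hg u) (pow_nonneg hu.1.le n)
  let T : BoundedContinuousFunction ℝ ℝ → BoundedContinuousFunction ℝ ℝ := fun y =>
    BoundedContinuousFunction.ofNormedAddCommGroup _ (hcontT y) (M / (n + 1))
      fun x => hbound _ M fun u => hM _ _
  have hT : ContractingWith ((n : NNReal) / (n + 1)) T := by
    refine ⟨?_, LipschitzWith.of_dist_le_mul fun y₁ y₂ => ?_⟩
    · rw [div_lt_one (by positivity)]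
      exact lt_add_one _
    · refine (BoundedContinuousFunction.dist_le
        (mul_nonneg (NNReal.coe_nonneg _) dist_nonneg)).2 fun x => ?_
      change dist (∫ u in (0 : ℝ)..1, u ^ n * G (x * u) (y₁ (x * u)))
        (∫ u in (0 : ℝ)..1, u ^ n * G (x * u) (y₂ (x * u))) ≤
          ((n : NNReal) / (n + 1) : NNReal) * dist y₁ y₂
      push_cast
      rw [dist_eq_norm, ← intervalIntegral.integral_sub (hint _ _) (hint _ _)]
      simp_rw [← mul_sub]
      refine (hbound _ (n * dist y₁ y₂) fun u => ?_).trans (le_of_eq (by ring))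
      exact (hlip _ _ _).trans (mul_le_mul_of_nonneg_left
        (BoundedContinuousFunction.dist_coe_le_dist (f := y₁) (g := y₂) (x * u)) n.cast_nonneg)
  obtain ⟨y, hy⟩ : ∃ y, T y = y := ⟨_, ContractingWith.fixedPoint_isFixedPt hT⟩
  refine ⟨y, y.continuous, fun x => ?_⟩
  conv_lhs => rw [← hy]
  rfl

/-- Multiplying (ty)' = h by tⁿ gives (tⁿ⁺¹y)' = tⁿ(ny + h), an integral equation after rescaling to
[0, 1]. For n ≥ K the map z ↦ nz + h is nondecreasing and n-Lipschitz, as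
`exists_continuous_eq_integral` needs; its monotonicity and the bounds at m and M confine y to [m,
M]. -/
theorem exists_singular_ode {m M K : ℝ} (hmM : m ≤ M) {h : ℝ → ℝ → ℝ}
    (hcont : ContinuousOn (Function.uncurry h) (univ ×ˢ Icc m M))
    (hanti : ∀ x, AntitoneOn (h x) (Icc m M))
    (hlip : ∀ x, ∀ z₁ ∈ Icc m M, ∀ z₂ ∈ Icc m M, z₁ ≤ z₂ → h x z₁ - h x z₂ ≤ K * (z₂ - z₁))
    (hlow : ∀ x, m ≤ h x m) (hhigh : ∀ x, h x M ≤ M) :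
    ∃ y : ℝ → ℝ, Continuous y ∧ (∀ x, y x ∈ Icc m M) ∧
      ∀ x, 0 < x → HasDerivAt (fun t => t * y t) (h x (y x)) x := by
  obtain ⟨n, hn⟩ := exists_nat_ge K
  -- Clamping makes G bounded and Lipschitz for all z; it has no effect once y is known to lie in
  -- [m, M].
  set cl : ℝ → ℝ := fun z => max m (min z M) with hcl
  have hclmem : ∀ z, cl z ∈ Icc m M := fun z => ⟨le_max_left _ _, max_le hmM (min_le_right _ _)⟩
  have hclcont : Continuous cl := by fun_prop
  have hclmono : Monotone cl := fun a b hab => max_le_max le_rfl (min_le_min hab le_rfl)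
  have hcllip : ∀ a b, a ≤ b → cl b - cl a ≤ b - a := by
    intro a b hab
    simp only [hcl]
    rcases le_total b M with h1 | h1 <;> rcases le_total a M with h2 | h2 <;>
      simp only [h1, h2, min_eq_left, min_eq_right] <;>
      rcases le_total m a with h3 | h3 <;> rcases le_total m b with h4 | h4 <;>
      simp only [h3, h4, hmM, max_eq_left, max_eq_right] <;> linarith
  set G : ℝ → ℝ → ℝ := fun x z => n * cl z + h x (cl z) with hGdef
  have hstep : ∀ x, ∀ z₁ ∈ Icc m M, ∀ z₂ ∈ Icc m M, z₁ ≤ z₂ →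
      0 ≤ (n * z₂ + h x z₂) - (n * z₁ + h x z₁) ∧
      (n * z₂ + h x z₂) - (n * z₁ + h x z₁) ≤ n * (z₂ - z₁) := by
    intro x z₁ h1 z₂ h2 h12
    have e1 := hlip x z₁ h1 z₂ h2 h12
    have e2 := hanti x h1 h2 h12
    have e3 : K * (z₂ - z₁) ≤ n * (z₂ - z₁) := mul_le_mul_of_nonneg_right hn (by linarith)
    constructor <;> linarith
  have hm : m ∈ Icc m M := left_mem_Icc.2 hmM
  have hM : M ∈ Icc m M := right_mem_Icc.2 hmM
  have hGlow : ∀ x z, (n + 1) * m ≤ G x z := fun x z => by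
    have := (hstep x m hm _ (hclmem z) (hclmem z).1).1
    have := hlow x
    simp only [hGdef]
    linarith
  have hGhigh : ∀ x z, G x z ≤ (n + 1) * M := fun x z => by
    have := (hstep x _ (hclmem z) M hM (hclmem z).2).1
    have := hhigh x
    simp only [hGdef]
    linarith
  have hGcont : Continuous (Function.uncurry G) := by
    have : Continuous fun q : ℝ × ℝ => Function.uncurry h (q.1, cl q.2) :=
      hcont.comp_continuous (by fun_prop) fun q => ⟨mem_univ _, hclmem _⟩
    have h2 : Continuous fun q : ℝ × ℝ => (n : ℝ) * cl q.2 := by fun_prop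
    exact h2.add this
  have hGlip : ∀ x z₁ z₂, |G x z₁ - G x z₂| ≤ n * |z₁ - z₂| := by
    intro x
    have key : ∀ z₁ z₂, z₁ ≤ z₂ → |G x z₁ - G x z₂| ≤ n * |z₁ - z₂| := by
      intro z₁ z₂ h12
      have e := hstep x _ (hclmem z₁) _ (hclmem z₂) (hclmono h12)
      have e2 := mul_le_mul_of_nonneg_left (hcllip z₁ z₂ h12) n.cast_nonneg (α := ℝ)
      rw [abs_sub_comm, abs_sub_comm z₁, abs_of_nonneg e.1, abs_of_nonneg (by linarith)]
      exact e.2.trans e2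
    intro z₁ z₂
    rcases le_total z₁ z₂ with h12 | h12
    · exact key _ _ h12
    · rw [abs_sub_comm, abs_sub_comm z₁]
      exact key _ _ h12
  obtain ⟨y, hy, hyeq⟩ := exists_continuous_eq_integral hGcont
    (fun x z => abs_le_max_abs_abs (hGlow x z) (hGhigh x z)) hGlip
  have hGy : Continuous fun t => G t (y t) :=
    hGcont.comp (by fun_prop : Continuous fun t => (t, y t))
  have hmem : ∀ x, y x ∈ Icc m M := by
    intro x
    have hpow : ∀ C : ℝ, ∫ u in (0 : ℝ)..1, u ^ n * ((n + 1) * C) = C := by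
      intro C
      rw [intervalIntegral.integral_mul_const, integral_pow]
      have : (n : ℝ) + 1 ≠ 0 := by positivity
      field_simp
      simp
    have hc : ∀ C : ℝ, IntervalIntegrable (fun u : ℝ => u ^ n * C) MeasureTheory.volume 0 1 :=
      fun C => (by fun_prop : Continuous fun u : ℝ => u ^ n * C).intervalIntegrable _ _
    have hi : IntervalIntegrable (fun u : ℝ => u ^ n * G (x * u) (y (x * u)))
        MeasureTheory.volume 0 1 :=
      ((continuous_id.pow n).mul (hGy.comp (continuous_const.mul continuous_id))).intervalIntegrable
        _ _
    rw [hyeq x]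
    constructor
    · rw [← hpow m]
      exact intervalIntegral.integral_mono_on zero_le_one (hc _) hi fun u hu =>
        mul_le_mul_of_nonneg_left (hGlow _ _) (pow_nonneg hu.1 n)
    · rw [← hpow M]
      exact intervalIntegral.integral_mono_on zero_le_one hi (hc _) fun u hu =>
        mul_le_mul_of_nonneg_left (hGhigh _ _) (pow_nonneg hu.1 n)
  refine ⟨y, hy, hmem, fun x hx => ?_⟩
  have hcly : ∀ x, cl (y x) = y x := fun x => by
    simp only [hcl]
    rw [min_eq_left (hmem x).2, max_eq_right (hmem x).1]
  have hprim : ∀ t, t ^ (n + 1) * y t = ∫ u in (0 : ℝ)..t, u ^ n * G u (y u) := by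
    intro t
    conv_lhs => rw [hyeq t]
    have := intervalIntegral.mul_integral_comp_mul_left (a := 0) (b := 1)
      (f := fun u => u ^ n * G u (y u)) t
    simp only [mul_zero, mul_one] at this
    rw [← this, pow_succ', mul_assoc, ← intervalIntegral.integral_const_mul]
    congr 2
    ext u
    ring
  have hd : HasDerivAt (fun t => t ^ (n + 1) * y t) (x ^ n * G x (y x)) x := by
    have hc : Continuous fun u : ℝ => u ^ n * G u (y u) := (continuous_id.pow n).mul hGy
    have := intervalIntegral.integral_hasDerivAt_right (hc.intervalIntegrable 0 x)
      (hc.stronglyMeasurableAtFilter _ _) hc.continuousAt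
    exact this.congr_of_eventuallyEq (Eventually.of_forall hprim)
  have hxn : x ^ n ≠ 0 := pow_ne_zero _ hx.ne'
  have hq := hd.div (hasDerivAt_pow n x) hxn
  have heq : (fun t => t * y t) =ᶠ[𝓝 x] (fun t => t ^ (n + 1) * y t) / fun t => t ^ n := by
    filter_upwards [lt_mem_nhds hx] with t ht
    have : t ^ n ≠ 0 := pow_ne_zero _ ht.ne'
    simp only [Pi.div_apply]
    field_simp
    ring
  refine (hq.congr_of_eventuallyEq heq).congr_deriv ?_
  simp only [hGdef, hcly]
  have e : x ^ (n + 1) * y x * (n * x ^ (n - 1)) = x ^ n * (n * (x ^ n * y x)) := by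
    rcases n with _ | k
    · simp
    · simp only [Nat.add_sub_cancel]
      ring
  rw [e]
  field_simp
  ring

/-! ### The comparison with a rotation. -/

-- For D = 2U - p², where p = xy, the terms in b cancel and D' = -p√D. Since U increases, p² ≤ 2U(H)
-- - D, so √(D/2U(H)) falls no faster than a cosine of angular speed 1/2. The equation is solved
-- with D truncated below at c², and the comparison then shows that the truncation is inactive.
set_option maxHeartbeats 1000000 in
theorem exists_profile {H : ℝ} {U b : ℝ → ℝ} (hH : 0 < H) (hHpi : H < Real.pi)
    (hb : ContinuousOn b (Icc 0 H)) (hb0 : ∀ x ∈ Icc 0 H, 0 ≤ b x)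
    (hU : ∀ x ∈ Icc 0 H, HasDerivWithinAt U (x * b x) (Icc 0 H) x)
    (hU0 : 0 < U 0) (hlt : U 0 < U H) (hsin : Real.sin (H / 2) ^ 2 * U H < U 0) :
    ∃ y v : ℝ → ℝ, Continuous y ∧ (∀ x ∈ Icc 0 H, 0 < y x) ∧ ContinuousOn v (Icc 0 H) ∧
      (∀ x ∈ Icc 0 H, v x < 0) ∧ (∀ x ∈ Icc 0 H, (x * y x) ^ 2 + v x ^ 2 = 2 * U x) ∧
      (∀ x ∈ Ioc 0 H, HasDerivAt (fun t => t * y t) (b x / y x - v x / 2) x) ∧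
      ∀ x ∈ Ioc 0 H, HasDerivWithinAt v (x * y x / 2) (Icc 0 H) x := by
  have hUc : ContinuousOn U (Icc 0 H) := fun x hx => (hU x hx).continuousWithinAt
  have hUmono : MonotoneOn U (Icc 0 H) := by
    refine monotoneOn_of_hasDerivWithinAt_nonneg (f' := fun x => x * b x) (convex_Icc 0 H) hUc
      (fun x hx => (hU x (interior_subset hx)).mono interior_subset) fun x hx => ?_
    have hx' := interior_subset hx
    exact mul_nonneg hx'.1 (hb0 x hx')
  have h0mem : (0 : ℝ) ∈ Icc 0 H := left_mem_Icc.2 hH.le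
  have hHmem : H ∈ Icc 0 H := right_mem_Icc.2 hH.le
  have hUH : 0 < U H := hU0.trans hlt
  -- the comparison angle
  set α := Real.arccos (√(U 0 / U H)) with hα
  have hq1 : √(U 0 / U H) < 1 := by
    rw [Real.sqrt_lt' one_pos, one_pow, div_lt_one hUH]
    exact hlt
  have hα0 : 0 < α := Real.arccos_pos.2 hq1
  have hcosα : Real.cos α = √(U 0 / U H) :=
    Real.cos_arccos (by linarith [Real.sqrt_nonneg (U 0 / U H)]) hq1.le
  have hα1 : α + H / 2 < Real.pi / 2 := by
    have h1 : Real.cos (Real.pi / 2 - H / 2) < Real.cos α := by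
      rw [Real.cos_pi_div_two_sub, hcosα]
      apply Real.lt_sqrt_of_sq_lt
      rwa [lt_div_iff₀ hUH]
    by_contra! hcon
    have := Real.cos_le_cos_of_nonneg_of_le_pi (by linarith : 0 ≤ Real.pi / 2 - H / 2)
      (Real.arccos_le_pi _ : α ≤ Real.pi) (by linarith)
    linarith
  -- A rate above 1/2 gives the strict inequality required at contact points; the witness spends
  -- half of the slack π/2 - α - H/2.
  obtain ⟨κ, hκ, hκH⟩ : ∃ κ : ℝ, 1 / 2 < κ ∧ α + κ * H < Real.pi / 2 := by
    refine ⟨1 / 2 + (Real.pi / 2 - α - H / 2) / (2 * H), ?_, ?_⟩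
    · have : 0 < (Real.pi / 2 - α - H / 2) / (2 * H) := div_pos (by linarith) (by linarith)
      linarith
    · have : (1 / 2 + (Real.pi / 2 - α - H / 2) / (2 * H)) * H
          = H / 2 + (Real.pi / 2 - α - H / 2) / 2 := by
        field_simp
      linarith
  set s := √(2 * U H) with hs
  have hs0 : 0 < s := Real.sqrt_pos.2 (by linarith)
  have hs2 : s ^ 2 = 2 * U H := Real.sq_sqrt (by linarith)
  have hκ0 : 0 < κ * H := mul_pos (by linarith) hH
  -- The value at x = H of the comparison bound for |v|, its least value on [0, H]; truncating there
  -- keeps the square root Lipschitz.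
  set c := s * Real.cos (α + κ * H) with hc
  have hc0 : 0 < c := mul_pos hs0 (Real.cos_pos_of_mem_Ioo ⟨by linarith, hκH⟩)
  have hcs : c ≤ s := mul_le_of_le_one_right hs0.le (Real.cos_le_one _)
  have hc2 : c ^ 2 ≤ 2 * U H := hs2 ▸ pow_le_pow_left₀ hc0.le hcs 2
  -- the clamped right-hand side
  set π₀ : ℝ → ℝ := fun x => max 0 (min x H) with hπ₀
  have hπmem : ∀ x, π₀ x ∈ Icc 0 H := fun x => ⟨le_max_left _ _, max_le hH.le (min_le_right _ _)⟩
  have hπc : Continuous π₀ := by fun_prop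
  have hπid : ∀ x ∈ Icc 0 H, π₀ x = x := fun x hx => by
    simp only [hπ₀]
    rw [min_eq_left hx.2, max_eq_right hx.1]
  obtain ⟨B, hB⟩ : ∃ B, ∀ x ∈ Icc 0 H, b x ≤ B := by
    obtain ⟨B, hB⟩ := isCompact_Icc.bddAbove_image hb
    exact ⟨B, fun x hx => hB (mem_image_of_mem b hx)⟩
  have hB0 : 0 ≤ B := (hb0 0 h0mem).trans (hB 0 h0mem)
  set A : ℝ → ℝ → ℝ := fun x z => max (c ^ 2) (2 * U (π₀ x) - (π₀ x * z) ^ 2) with hA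
  set h : ℝ → ℝ → ℝ := fun x z => b (π₀ x) / z + √(A x z) / 2 with hh
  have hAc : ∀ x z, c ≤ √(A x z) := fun x z => Real.le_sqrt_of_sq_le (le_max_left _ _)
  have hAs : ∀ x z, √(A x z) ≤ s := fun x z => by
    refine Real.sqrt_le_sqrt (max_le hc2 ?_)
    have := hUmono (hπmem x) hHmem (hπmem x).2
    nlinarith [sq_nonneg (π₀ x * z)]
  -- Barriers: h ≥ √A/2 ≥ c/2 everywhere, and h(x, M) ≤ B + s/2 because M ≥ 1.
  set m := c / 2 with hm
  set M := 1 + B + s with hM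
  have hm0 : 0 < m := by positivity
  have hmM : m ≤ M := by linarith
  have hM1 : 1 ≤ M := by linarith
  have hanti : ∀ x, AntitoneOn (h x) (Icc m M) := by
    intro x z₁ h1 z₂ h2 h12
    have hz1 : 0 < z₁ := hm0.trans_le h1.1
    refine add_le_add (div_le_div_of_nonneg_left (hb0 _ (hπmem x)) hz1 h12) ?_
    refine div_le_div_of_nonneg_right (Real.sqrt_le_sqrt (max_le_max le_rfl ?_)) zero_le_two
    have : (π₀ x * z₁) ^ 2 ≤ (π₀ x * z₂) ^ 2 :=
      pow_le_pow_left₀ (mul_nonneg (hπmem x).1 hz1.le) (mul_le_mul_of_nonneg_left h12 (hπmem x).1) 2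
    linarith
  have hlip : ∀ x, ∀ z₁ ∈ Icc m M, ∀ z₂ ∈ Icc m M, z₁ ≤ z₂ →
      h x z₁ - h x z₂ ≤ (B / m ^ 2 + H ^ 2 * M / (2 * c)) * (z₂ - z₁) := by
    intro x z₁ h1 z₂ h2 h12
    have hz1 : 0 < z₁ := hm0.trans_le h1.1
    have hz2 : 0 < z₂ := hm0.trans_le h2.1
    have e1 : b (π₀ x) / z₁ - b (π₀ x) / z₂ ≤ B / m ^ 2 * (z₂ - z₁) := by
      have : b (π₀ x) / z₁ - b (π₀ x) / z₂ = b (π₀ x) / (z₁ * z₂) * (z₂ - z₁) := by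
        field_simp
      rw [this]
      refine mul_le_mul_of_nonneg_right ?_ (by linarith)
      refine div_le_div₀ hB0 (hB _ (hπmem x)) (by positivity) ?_
      rw [sq]
      exact mul_le_mul h1.1 h2.1 hm0.le hz1.le
    have e2 : A x z₁ - A x z₂ ≤ H ^ 2 * (2 * M) * (z₂ - z₁) := by
      have e3 : (π₀ x) ^ 2 * ((z₂ + z₁) * (z₂ - z₁)) ≤ H ^ 2 * (2 * M * (z₂ - z₁)) := by
        refine mul_le_mul (pow_le_pow_left₀ (hπmem x).1 (hπmem x).2 2)
          (mul_le_mul_of_nonneg_right (by linarith [h1.2, h2.2]) (by linarith))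
          (mul_nonneg (by linarith) (by linarith)) (by positivity)
      have e4 : 0 ≤ (π₀ x) ^ 2 * ((z₂ + z₁) * (z₂ - z₁)) :=
        mul_nonneg (sq_nonneg _) (mul_nonneg (by linarith) (by linarith))
      have e5 : A x z₁ ≤ A x z₂ + (π₀ x) ^ 2 * ((z₂ + z₁) * (z₂ - z₁)) := by
        refine max_le ?_ ?_
        · have := le_max_left (c ^ 2) (2 * U (π₀ x) - (π₀ x * z₂) ^ 2)
          simp only [hA]
          linarith
        · have := le_max_right (c ^ 2) (2 * U (π₀ x) - (π₀ x * z₂) ^ 2)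
          simp only [hA]
          linarith
      linarith
    have e6 : √(A x z₁) / 2 - √(A x z₂) / 2 ≤ H ^ 2 * M / (2 * c) * (z₂ - z₁) := by
      have a1 := hAc x z₁
      have a2 := hAc x z₂
      have q1 : √(A x z₁) ^ 2 = A x z₁ := Real.sq_sqrt ((sq_nonneg c).trans (le_max_left _ _))
      have q2 : √(A x z₂) ^ 2 = A x z₂ := Real.sq_sqrt ((sq_nonneg c).trans (le_max_left _ _))
      have hA12 : √(A x z₂) ≤ √(A x z₁) := by
        refine Real.sqrt_le_sqrt (max_le_max le_rfl ?_)
        have : (π₀ x * z₁) ^ 2 ≤ (π₀ x * z₂) ^ 2 :=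
          pow_le_pow_left₀ (mul_nonneg (hπmem x).1 hz1.le)
            (mul_le_mul_of_nonneg_left h12 (hπmem x).1) 2
        linarith
      rw [div_mul_eq_mul_div, le_div_iff₀ (by positivity)]
      have := mul_le_mul_of_nonneg_left (add_le_add a1 a2) (sub_nonneg.2 hA12)
      nlinarith
    simp only [hh]
    linarith
  have hcont : ContinuousOn (Function.uncurry h) (univ ×ˢ Icc m M) := by
    have c1 : Continuous fun x => b (π₀ x) := hb.comp_continuous hπc hπmem
    have c2 : Continuous fun x => U (π₀ x) := hUc.comp_continuous hπc hπmem
    have c3 : Continuous fun q : ℝ × ℝ => √(A q.1 q.2) / 2 :=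
      (continuous_const.max (((c2.comp continuous_fst).const_mul 2).sub
        (((hπc.comp continuous_fst).mul continuous_snd).pow 2))).sqrt.div_const 2
    exact ((c1.comp continuous_fst).continuousOn.div continuous_snd.continuousOn
      fun q hq => (hm0.trans_le hq.2.1).ne').add c3.continuousOn
  obtain ⟨y, hy, hymem, hyd⟩ := exists_singular_ode hmM hcont hanti hlip
    (fun x => by
      have := div_nonneg (hb0 _ (hπmem x)) hm0.le
      have := hAc x m
      simp only [hh]
      linarith)
    (fun x => by
      have e1 : b (π₀ x) / M ≤ B := by
        rw [div_le_iff₀ (by linarith)]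
        nlinarith [hB _ (hπmem x)]
      have := hAs x M
      simp only [hh]
      linarith)
  have hy0 : ∀ x, 0 < y x := fun x => hm0.trans_le (hymem x).1
  set D : ℝ → ℝ := fun x => 2 * U x - (x * y x) ^ 2 with hD
  have hAD : ∀ x ∈ Icc 0 H, A x (y x) = max (c ^ 2) (D x) := fun x hx => by
    simp only [hA, hD, hπid x hx]
  -- The slope of t·y(t) at 0 is y itself, so continuity of y suffices.
  have hyd0 : HasDerivAt (fun t => t * y t) (y 0) 0 := by
    rw [hasDerivAt_iff_tendsto_slope]
    refine (hy.continuousAt.tendsto.mono_left nhdsWithin_le_nhds).congr' ?_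
    filter_upwards [self_mem_nhdsWithin] with t ht
    have : t ≠ 0 := ht
    simp only [slope_def_field]
    field_simp
    ring
  have hDd : ∀ x ∈ Icc 0 H,
      HasDerivWithinAt D (-(x * y x * √(max (c ^ 2) (D x)))) (Icc 0 H) x := by
    intro x hx
    rcases hx.1.eq_or_lt with rfl | hx0
    · refine (((hU 0 hx).const_mul 2).sub (hyd0.pow 2).hasDerivWithinAt).congr_deriv ?_
      simp
    · refine (((hU x hx).const_mul 2).sub ((hyd x hx0).pow 2).hasDerivWithinAt).congr_deriv ?_
      simp only [hh, hAD x hx, hπid x hx]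
      have := (hy0 x).ne'
      field_simp
      ring
  have hDlow : ∀ x ∈ Icc 0 H, -D x ≤ -(2 * U H) * Real.cos (α + κ * x) ^ 2 := by
    have hBd : ∀ x, HasDerivAt (fun x => -(2 * U H) * Real.cos (α + κ * x) ^ 2)
        (2 * κ * (2 * U H * (Real.sin (α + κ * x) * Real.cos (α + κ * x)))) x := by
      intro x
      have h1 : HasDerivAt (fun x => α + κ * x) κ x := by
        simpa using ((hasDerivAt_id x).const_mul κ).const_add α
      refine (((h1.cos).pow 2).const_mul (-(2 * U H))).congr_deriv ?_
      simp
      ring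
    refine image_le_of_deriv_right_lt_deriv_boundary'
      (f' := fun x => x * y x * √(max (c ^ 2) (D x)))
      (fun x hx => (hDd x hx).continuousWithinAt.neg) (fun x hx => ?_) ?_
      (fun x _ => (hBd x).continuousAt.continuousWithinAt) (fun x _ => (hBd x).hasDerivWithinAt) ?_
    · have := (hDd x (Ico_subset_Icc_self hx)).neg.mono_of_mem_nhdsWithin
        (Icc_mem_nhdsGE_of_mem hx)
      simpa using this
    · simp only [hD, mul_zero, add_zero, hcosα]
      rw [Real.sq_sqrt (by positivity)]
      field_simp
      simp
    -- At a contact point D = s²cos²θ ≥ c², so the truncation is inactive and p ≤ s sin θ.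
    · intro x hx heq
      have hxI := Ico_subset_Icc_self hx
      have hκx : κ * x ≤ κ * H := mul_le_mul_of_nonneg_left hx.2.le (by linarith)
      have hκx0 : 0 ≤ κ * x := mul_nonneg (by linarith) hx.1
      set θ := α + κ * x with hθ
      have hcosθ : 0 < Real.cos θ := Real.cos_pos_of_mem_Ioo ⟨by linarith, by linarith⟩
      have hsinθ : 0 < Real.sin θ := Real.sin_pos_of_pos_of_lt_pi (by linarith) (by linarith)
      have hDθ : D x = (s * Real.cos θ) ^ 2 := by
        rw [mul_pow, hs2]
        have : -D x = -(2 * U H) * Real.cos θ ^ 2 := heq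
        linarith
      have hcθ : c ≤ s * Real.cos θ := mul_le_mul_of_nonneg_left
        (Real.cos_le_cos_of_nonneg_of_le_pi (by linarith) (by linarith) (by linarith)) hs0.le
      have hmax : √(max (c ^ 2) (D x)) = s * Real.cos θ := by
        rw [hDθ, max_eq_right (pow_le_pow_left₀ hc0.le hcθ 2), Real.sqrt_sq (by positivity)]
      have hp : x * y x ≤ s * Real.sin θ := by
        refine le_of_abs_le (abs_le_of_sq_le_sq ?_ (by positivity))
        have h1 : (x * y x) ^ 2 = 2 * U x - D x := by simp only [hD]; ring
        have h2 := hUmono hxI hHmem hxI.2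
        have h3 := Real.sin_sq_add_cos_sq θ
        rw [h1, hDθ, mul_pow, mul_pow, hs2]
        nlinarith
      rw [hmax]
      have h4 : x * y x * (s * Real.cos θ) ≤ s * Real.sin θ * (s * Real.cos θ) :=
        mul_le_mul_of_nonneg_right hp (by positivity)
      have h5 : s * Real.sin θ * (s * Real.cos θ)
          = 2 * U H * (Real.sin θ * Real.cos θ) := by rw [← hs2]; ring
      have h6 : 0 < 2 * U H * (Real.sin θ * Real.cos θ) := by positivity
      exact (h4.trans_eq h5).trans_lt (lt_mul_of_one_lt_left h6 (by linarith))
  have hDc : ∀ x ∈ Icc 0 H, c ^ 2 ≤ D x := by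
    intro x hx
    have hκx : κ * x ≤ κ * H := mul_le_mul_of_nonneg_left hx.2 (by linarith)
    have hκx0 : 0 ≤ κ * x := mul_nonneg (by linarith) hx.1
    have hcθ : c ≤ s * Real.cos (α + κ * x) := mul_le_mul_of_nonneg_left
      (Real.cos_le_cos_of_nonneg_of_le_pi (by linarith) (by linarith) (by linarith)) hs0.le
    have h1 := pow_le_pow_left₀ hc0.le hcθ 2
    rw [mul_pow s (Real.cos (α + κ * x)), hs2] at h1
    linarith [hDlow x hx]
  have hD0 : ∀ x ∈ Icc 0 H, 0 < D x := fun x hx => lt_of_lt_of_le (by positivity) (hDc x hx)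
  refine ⟨y, fun x => -√(D x), hy, fun x _ => hy0 x, fun x hx =>
    ((hDd x hx).continuousWithinAt.sqrt).neg, fun x hx => neg_lt_zero.2 (Real.sqrt_pos.2 (hD0 x hx)),
    fun x hx => ?_, fun x hx => ?_, fun x hx => ?_⟩
  · rw [neg_sq, Real.sq_sqrt (hD0 x hx).le]
    simp only [hD]
    ring
  · have hxI := Ioc_subset_Icc_self hx
    refine (hyd x hx.1).congr_deriv ?_
    simp only [hh, hAD x hxI, hπid x hxI, max_eq_right (hDc x hxI)]
    ring
  · have hxI := Ioc_subset_Icc_self hx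
    refine ((hDd x hxI).sqrt (hD0 x hxI).ne').neg.congr_deriv ?_
    rw [max_eq_right (hDc x hxI)]
    have := (Real.sqrt_pos.2 (hD0 x hxI)).ne'
    field_simp

/-! ### Time parametrization. -/

/-- τ is the inverse of the travel time ∫ 1/k; the upper bound on k makes that time unbounded in
both directions. Continuity of k is enough. -/
theorem exists_flow_of_bounds {k : ℝ → ℝ} (hk : Continuous k) {m M : ℝ} (hm : 0 < m)
    (hkm : ∀ t, m ≤ k t) (hkM : ∀ t, k t ≤ M) :
    ∃ τ : ℝ → ℝ, τ 0 = 0 ∧ Monotone τ ∧ (∀ s, HasDerivAt τ (k (τ s)) s) ∧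
      Tendsto τ atBot atBot := by
  have hk0 : ∀ t, 0 < k t := fun t => hm.trans_le (hkm t)
  have hM : 0 < M := (hk0 0).trans_le (hkM 0)
  have hki : Continuous fun t => (k t)⁻¹ := hk.inv₀ fun t => (hk0 t).ne'
  set σ : ℝ → ℝ := fun t => ∫ u in (0 : ℝ)..t, (k u)⁻¹ with hσ
  have hσd : ∀ t, HasDerivAt σ (k t)⁻¹ t := fun t =>
    intervalIntegral.integral_hasDerivAt_right (hki.intervalIntegrable _ _)
      (hki.stronglyMeasurableAtFilter _ _) hki.continuousAt
  have hσmono : StrictMono σ := strictMono_of_hasDerivAt_pos hσd fun t => inv_pos.2 (hk0 t)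
  have hσc : Continuous σ := continuous_iff_continuousAt.2 fun t => (hσd t).continuousAt
  have hgrow : Monotone fun t => σ t - M⁻¹ * t := by
    refine monotone_of_hasDerivAt_nonneg
      (fun t => (hσd t).sub ((hasDerivAt_id t).const_mul M⁻¹)) fun t => ?_
    have := inv_anti₀ (hk0 t) (hkM t)
    simpa using this
  have hσ0 : σ 0 = 0 := by simp [hσ]
  have htop : Tendsto σ atTop atTop := by
    refine tendsto_atTop_mono' _ ?_ (tendsto_id.const_mul_atTop (inv_pos.2 hM))
    filter_upwards [eventually_ge_atTop 0] with t ht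
    have := hgrow ht
    simp only [hσ0] at this
    simp only [id]
    linarith
  have hbot : Tendsto σ atBot atBot := by
    refine tendsto_atBot_mono' _ ?_ (tendsto_id.const_mul_atBot (inv_pos.2 hM))
    filter_upwards [eventually_le_atBot 0] with t ht
    have := hgrow ht
    simp only [hσ0] at this
    simp only [id]
    linarith
  let e : ℝ ≃o ℝ := hσmono.orderIsoOfSurjective σ (hσc.surjective htop hbot)
  have he : ∀ t, e t = σ t := fun t => rfl
  refine ⟨e.symm, ?_, e.symm.monotone, fun s => ?_, e.symm.tendsto_atBot⟩
  · rw [e.symm_apply_eq, he, hσ0]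
  · have := HasDerivAt.of_local_left_inverse (f := σ) (g := e.symm) (a := s)
      e.symm.continuous.continuousAt (hσd _) (inv_pos.2 (hk0 _)).ne'
      (Eventually.of_forall fun t => by rw [← he, e.apply_symm_apply])
    rwa [inv_inv] at this

/-! ### The potential between φL and φm, and the profile of the branch. -/

variable {φa φb φL φR : ℝ} {V : ℝ → ℝ}

/-- The profile of the branch over `[φL, φL + H]`: with `x = φ - φL`, its shape velocity is
`F φ * (x * y x)` and its size velocity is `v x`. -/
structure IsBranchProfile (φL H : ℝ) (V y v : ℝ → ℝ) : Prop where
  continuous : Continuous y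
  pos : ∀ x ∈ Icc 0 H, 0 < y x
  continuousOn : ContinuousOn v (Icc 0 H)
  neg : ∀ x ∈ Icc 0 H, v x < 0
  energy : ∀ x ∈ Icc 0 H, (x * y x) ^ 2 + v x ^ 2 = 2 * V (φL + x)
  hasDerivAt : ∀ x ∈ Ioc 0 H,
    HasDerivAt (fun t => t * y t) (deriv V (φL + x) / (x * y x) - v x / 2) x
  hasDerivWithinAt : ∀ x ∈ Ioc 0 H, HasDerivWithinAt v (x * y x / 2) (Icc 0 H) x

namespace IsShapePotential

theorem sin_left_pos (hV : IsShapePotential φa φb φL φR V) {φ : ℝ} (hφ : φ ∈ Ioo φa φb) :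
    0 < Real.sin (φ - φa) :=
  Real.sin_pos_of_pos_of_lt_pi (sub_pos.2 hφ.1) (by linarith [hV.le_pi, hφ.2])

theorem sin_right_pos (hV : IsShapePotential φa φb φL φR V) {φ : ℝ} (hφ : φ ∈ Ioo φa φb) :
    0 < Real.sin (φb - φ) :=
  Real.sin_pos_of_pos_of_lt_pi (sub_pos.2 hφ.2) (by linarith [hV.le_pi, hφ.1])

theorem contDiffOn (hV : IsShapePotential φa φb φL φR V) : ContDiffOn ℝ 3 V (Ioo φa φb) := by
  obtain ⟨β₁, β₂, Vhat, -, -, -, hC, -, -, hform⟩ := hV.form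
  refine ContDiffOn.congr ?_ hform
  refine ((contDiffOn_const.div (by fun_prop) fun φ hφ => (hV.sin_right_pos hφ).ne').add
    (contDiffOn_const.div (by fun_prop) fun φ hφ => (hV.sin_left_pos hφ).ne')).add hC

theorem pos (hV : IsShapePotential φa φb φL φR V) {φ : ℝ} (hφ : φ ∈ Ioo φa φb) : 0 < V φ := by
  obtain ⟨β₁, β₂, Vhat, h1, h2, -, -, h3, -, hform⟩ := hV.form
  rw [hform φ hφ]
  have e1 := div_pos h1 (hV.sin_right_pos hφ)
  have e2 := div_nonneg h2 (hV.sin_left_pos hφ).le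
  have e3 := h3 φ hφ
  linarith

theorem hasDerivAt (hV : IsShapePotential φa φb φL φR V) {φ : ℝ} (hφ : φ ∈ Ioo φa φb) :
    HasDerivAt V (deriv V φ) φ :=
  ((hV.contDiffOn.differentiableOn (by norm_num)).differentiableAt
    (isOpen_Ioo.mem_nhds hφ)).hasDerivAt

theorem contDiffOn_deriv (hV : IsShapePotential φa φb φL φR V) :
    ContDiffOn ℝ 2 (deriv V) (Ioo φa φb) :=
  hV.contDiffOn.deriv_of_isOpen isOpen_Ioo (by norm_num)

theorem critical_iff (hV : IsShapePotential φa φb φL φR V) {φ : ℝ} :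
    φ ∈ Ioo φa φb ∧ deriv V φ = 0 ↔ φ = φL ∨ φ = (φa + φb) / 2 ∨ φ = φR := by
  have : φ ∈ {φ | φ ∈ Ioo φa φb ∧ deriv V φ = 0} ↔ φ ∈ ({φL, (φa + φb) / 2, φR} : Set ℝ) := by
    rw [hV.critical]
  simpa using this

theorem left_mem (hV : IsShapePotential φa φb φL φR V) : φL ∈ Ioo φa φb :=
  (hV.critical_iff.2 (Or.inl rfl)).1

theorem deriv_left (hV : IsShapePotential φa φb φL φR V) : deriv V φL = 0 :=
  (hV.critical_iff.2 (Or.inl rfl)).2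

theorem deriv_mid (hV : IsShapePotential φa φb φL φR V) : deriv V ((φa + φb) / 2) = 0 :=
  (hV.critical_iff.2 (Or.inr (Or.inl rfl))).2

theorem mem_Ioo_of_mem_Icc (hV : IsShapePotential φa φb φL φR V) {φ : ℝ}
    (hφ : φ ∈ Icc φL ((φa + φb) / 2)) : φ ∈ Ioo φa φb :=
  ⟨hV.left_mem.1.trans_le hφ.1, hφ.2.trans_lt (by linarith [hV.lt])⟩

/-- Reflection sends φL to a critical point to the right of φm, and φR is the only one. -/
theorem right_eq (hV : IsShapePotential φa φb φL φR V) : φR = φa + φb - φL := by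
  have hL := hV.left_mem
  have hmem : φa + φb - φL ∈ Ioo φa φb := ⟨by linarith [hL.2], by linarith [hL.1]⟩
  have hd : HasDerivAt (fun φ => V (φa + φb - φ)) (-deriv V (φa + φb - φL)) φL :=
    (hV.hasDerivAt hmem).comp_const_sub (φa + φb) φL
  have heq : (fun φ => V (φa + φb - φ)) =ᶠ[𝓝 φL] V := by
    filter_upwards [isOpen_Ioo.mem_nhds hL] with φ hφ using hV.symmetric φ hφ
  have h0 : deriv V (φa + φb - φL) = 0 := by
    have := hd.deriv
    rw [heq.deriv_eq, hV.deriv_left] at this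
    linarith
  have hlt := hV.left_lt
  rcases hV.critical_iff.1 ⟨hmem, h0⟩ with h | h | h
  · linarith
  · linarith
  · exact h.symm

theorem right_value (hV : IsShapePotential φa φb φL φR V) : V φR = V φL := by
  rw [hV.right_eq, hV.symmetric φL hV.left_mem]

/-- Blow-up at φa. If β₂ = 0 the interval has length π and sin(φb - φ) = sin(φ - φa), so the β₁ term
supplies the pole. -/
theorem exists_div_sub_le (hV : IsShapePotential φa φb φL φR V) :
    ∃ g > 0, ∀ φ ∈ Ioo φa φb, g / (φ - φa) ≤ V φ := by
  obtain ⟨β₁, β₂, Vhat, h1, h2, hβ, -, h3, -, hform⟩ := hV.form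
  have key : ∀ g > 0, ∀ φ ∈ Ioo φa φb, g / (φ - φa) ≤ g / Real.sin (φ - φa) := fun g hg φ hφ =>
    div_le_div_of_nonneg_left hg.le (hV.sin_left_pos hφ) (Real.sin_le (sub_pos.2 hφ.1).le)
  rcases h2.eq_or_lt with h20 | h20
  · refine ⟨β₁, h1, fun φ hφ => (key β₁ h1 φ hφ).trans ?_⟩
    have hpi := hβ.1 h20.symm
    have hs : Real.sin (φb - φ) = Real.sin (φ - φa) := by
      rw [← Real.sin_pi_sub, ← hpi]
      congr 1
      ring
    rw [hform φ hφ, hs, ← h20]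
    have := h3 φ hφ
    simp only [zero_div]
    linarith
  · refine ⟨β₂, h20, fun φ hφ => (key β₂ h20 φ hφ).trans ?_⟩
    rw [hform φ hφ]
    have := h3 φ hφ
    have := div_pos h1 (hV.sin_right_pos hφ)
    linarith

/-- V' has constant sign between critical points; a positive sign would keep V bounded above near
φa, against the pole. -/
theorem deriv_neg_of_lt_left (hV : IsShapePotential φa φb φL φR V) {φ : ℝ}
    (hφ : φ ∈ Ioo φa φL) : deriv V φ < 0 := by
  have hlt := hV.left_lt
  have hlt' := hV.lt_right
  have hsub : Ioo φa φL ⊆ Ioo φa φb := Ioo_subset_Ioo_right hV.left_mem.2.le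
  rcases hasDerivWithinAt_forall_lt_or_forall_gt_of_forall_ne (convex_Ioo φa φL) (f := V)
    (f' := deriv V) (m := 0) (fun x hx => (hV.hasDerivAt (hsub hx)).hasDerivWithinAt)
    (fun x hx h0 => by
      rcases hV.critical_iff.1 ⟨hsub hx, h0⟩ with h | h | h <;> linarith [hx.2]) with h | h
  · exact h φ hφ
  · exfalso
    have hmono : StrictMonoOn V (Ioo φa φL) := by
      refine strictMonoOn_of_deriv_pos (convex_Ioo φa φL)
        (fun x hx => (hV.hasDerivAt (hsub hx)).continuousAt.continuousWithinAt) fun x hx => ?_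
      rw [interior_Ioo] at hx
      exact h x hx
    obtain ⟨g, hg, hgV⟩ := hV.exists_div_sub_le
    have hVφ := hV.pos (hsub hφ)
    have hφ' : 0 < φ - φa := sub_pos.2 hφ.1
    obtain ⟨δ, hδ0, hδ1, hδ2⟩ : ∃ δ > 0, δ < φ - φa ∧ δ < g / V φ := by
      obtain ⟨δ, h0, h1⟩ := exists_between (lt_min hφ' (div_pos hg hVφ))
      exact ⟨δ, h0, h1.trans_le (min_le_left _ _), h1.trans_le (min_le_right _ _)⟩
    have hx : φa + δ ∈ Ioo φa φL := ⟨by linarith, by linarith [hφ.2]⟩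
    have h1 := hmono hx hφ (by linarith)
    have h2 := hgV _ (hsub hx)
    rw [add_sub_cancel_left, div_le_iff₀ hδ0] at h2
    rw [lt_div_iff₀ hVφ] at hδ2
    nlinarith

/-- V' < 0 to the left of φL makes V'' nonnegative there, and non-degeneracy excludes 0. -/
theorem deriv_deriv_left_pos (hV : IsShapePotential φa φb φL φR V) :
    0 < deriv (deriv V) φL := by
  have hd : HasDerivAt (deriv V) (deriv (deriv V) φL) φL :=
    ((hV.contDiffOn_deriv.differentiableOn (by norm_num)).differentiableAt
      (isOpen_Ioo.mem_nhds hV.left_mem)).hasDerivAt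
  refine lt_of_le_of_ne ?_ (hV.nondegenerate φL hV.left_mem hV.deriv_left).symm
  have hs := (hasDerivAt_iff_tendsto_slope.1 hd).mono_left
    (nhdsWithin_mono φL (fun x (hx : x < φL) => hx.ne) : 𝓝[<] φL ≤ 𝓝[≠] φL)
  refine ge_of_tendsto hs ?_
  filter_upwards [Ioo_mem_nhdsLT hV.left_mem.1] with x hx
  rw [slope_def_field, hV.deriv_left, sub_zero]
  exact (div_pos_of_neg_of_neg (hV.deriv_neg_of_lt_left hx) (sub_neg.2 hx.2)).le

/-- V' has constant sign here, and a negative sign would give V''(φL) ≤ 0. -/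
theorem deriv_pos (hV : IsShapePotential φa φb φL φR V) {φ : ℝ}
    (hφ : φ ∈ Ioo φL ((φa + φb) / 2)) : 0 < deriv V φ := by
  have hlt := hV.left_lt
  have hlt' := hV.lt_right
  have hsub : Ioo φL ((φa + φb) / 2) ⊆ Ioo φa φb := fun x hx =>
    hV.mem_Ioo_of_mem_Icc (Ioo_subset_Icc_self hx)
  rcases hasDerivWithinAt_forall_lt_or_forall_gt_of_forall_ne
    (convex_Ioo φL ((φa + φb) / 2)) (f := V)
    (f' := deriv V) (m := 0) (fun x hx => (hV.hasDerivAt (hsub hx)).hasDerivWithinAt)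
    (fun x hx h0 => by
      rcases hV.critical_iff.1 ⟨hsub hx, h0⟩ with h | h | h <;> linarith [hx.1, hx.2]) with h | h
  · exfalso
    have hd : HasDerivAt (deriv V) (deriv (deriv V) φL) φL :=
      ((hV.contDiffOn_deriv.differentiableOn (by norm_num)).differentiableAt
        (isOpen_Ioo.mem_nhds hV.left_mem)).hasDerivAt
    have hs := (hasDerivAt_iff_tendsto_slope.1 hd).mono_left
      (nhdsWithin_mono φL (fun x (hx : φL < x) => hx.ne') : 𝓝[>] φL ≤ 𝓝[≠] φL)
    refine (not_lt.2 (le_of_tendsto hs ?_)) hV.deriv_deriv_left_pos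
    filter_upwards [Ioo_mem_nhdsGT hlt] with x hx
    rw [slope_def_field, hV.deriv_left, sub_zero]
    exact (div_neg_of_neg_of_pos (h x hx) (sub_pos.2 hx.1)).le
  · exact h φ hφ

theorem strictMonoOn (hV : IsShapePotential φa φb φL φR V) :
    StrictMonoOn V (Icc φL ((φa + φb) / 2)) := by
  refine strictMonoOn_of_deriv_pos (convex_Icc _ _)
    (fun x hx => (hV.hasDerivAt (hV.mem_Ioo_of_mem_Icc hx)).continuousAt.continuousWithinAt)
    fun x hx => ?_
  rw [interior_Icc] at hx
  exact hV.deriv_pos hx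

theorem deriv_nonneg (hV : IsShapePotential φa φb φL φR V) {φ : ℝ}
    (hφ : φ ∈ Icc φL ((φa + φb) / 2)) : 0 ≤ deriv V φ := by
  rcases hφ.1.eq_or_lt with h1 | h1
  · rw [← h1, hV.deriv_left]
  · rcases hφ.2.eq_or_lt with h2 | h2
    · rw [h2, hV.deriv_mid]
    · exact (hV.deriv_pos ⟨h1, h2⟩).le

theorem exists_branch_profile (hV : IsShapePotential φa φb φL φR V)
    (hN2 : V φR > Real.sin ((φR - (φa + φb) / 2) / 2) ^ 2 * V ((φa + φb) / 2)) :
    ∃ y v : ℝ → ℝ, IsBranchProfile φL ((φa + φb) / 2 - φL) V y v := by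
  set H := (φa + φb) / 2 - φL with hH
  have hlt := hV.left_lt
  have hR := hV.right_eq
  have hmem : ∀ x ∈ Icc 0 H, φL + x ∈ Icc φL ((φa + φb) / 2) := fun x hx =>
    ⟨by linarith [hx.1], by linarith [hx.2]⟩
  -- V'/x, extended continuously by V''(φL) at x = 0.
  set b : ℝ → ℝ := fun x => dslope (deriv V) φL (φL + x) with hb
  have hxb : ∀ x, x * b x = deriv V (φL + x) := by
    intro x
    have := sub_smul_dslope (deriv V) φL (φL + x)
    rwa [add_sub_cancel_left, hV.deriv_left, sub_zero, smul_eq_mul] at this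
  have hb0 : ∀ x ∈ Icc 0 H, 0 ≤ b x := by
    intro x hx
    rcases hx.1.eq_or_lt with h | h
    · simp only [hb, ← h, add_zero, dslope_same]
      exact hV.deriv_deriv_left_pos.le
    · have := hV.deriv_nonneg (hmem x hx)
      rw [← hxb] at this
      exact nonneg_of_mul_nonneg_right this h
  have hbc : ContinuousOn b (Icc 0 H) := by
    have hc : ContinuousOn (dslope (deriv V) φL) (Ioo φa φb) :=
      (continuousOn_dslope (isOpen_Ioo.mem_nhds hV.left_mem)).2
        ⟨hV.contDiffOn_deriv.continuousOn, (hV.contDiffOn_deriv.differentiableOn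
          (by norm_num)).differentiableAt (isOpen_Ioo.mem_nhds hV.left_mem)⟩
    exact hc.comp (by fun_prop) fun x hx => hV.mem_Ioo_of_mem_Icc (hmem x hx)
  have hHm : φL + H = (φa + φb) / 2 := by rw [hH]; ring
  have hHR : φR - (φa + φb) / 2 = H := by rw [hR, hH]; ring
  obtain ⟨y, v, h1, h2, h3, h4, h5, h6, h7⟩ := exists_profile (U := fun x => V (φL + x))
    (sub_pos.2 hlt) (by linarith [hV.left_mem.1, hV.le_pi, hV.lt]) hbc hb0
    (fun x hx => by
      rw [hxb]
      exact ((hV.hasDerivAt (hV.mem_Ioo_of_mem_Icc (hmem x hx))).comp_const_add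
        φL x).hasDerivWithinAt)
    (by simpa using hV.pos hV.left_mem)
    (by
      simp only [add_zero]
      rw [← hH, hHm]
      exact hV.strictMonoOn (left_mem_Icc.2 hlt.le) (right_mem_Icc.2 hlt.le) hlt)
    (by
      simp only [add_zero]
      rw [← hH, hHm, ← hV.right_value, ← hHR]
      exact hN2)
  refine ⟨y, v, ⟨h1, h2, h3, h4, h5, fun x hx => (h6 x hx).congr_deriv ?_, h7⟩⟩
  rw [← hxb, mul_div_mul_left _ _ hx.1.ne']

end IsShapePotential

/-! ### The collision manifold in the scaled velocity p = w/F. -/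

theorem hasDerivAt_f (φa φb φ : ℝ) : HasDerivAt (f φa φb) (deriv (f φa φb) φ) φ := by
  refine DifferentiableAt.hasDerivAt ?_
  unfold f
  split_ifs <;> fun_prop

namespace IsShapePotential

theorem f_pos (hV : IsShapePotential φa φb φL φR V) {φ : ℝ} (hφ : φ ∈ Ioo φa φb) :
    0 < f φa φb φ := by
  unfold f
  split_ifs
  · exact mul_pos (hV.sin_left_pos hφ) (hV.sin_right_pos hφ)
  · exact hV.sin_right_pos hφ

theorem F_eq (hV : IsShapePotential φa φb φL φR V) {φ : ℝ} (hφ : φ ∈ Ioo φa φb) :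
    F φa φb V φ = √(f φa φb φ / V φ) := by
  have h1 := hV.f_pos hφ
  have h2 := hV.pos hφ
  rw [F, W, Real.sqrt_mul h1.le, Real.sqrt_div h1.le, ← div_div, Real.div_sqrt]

theorem F_pos (hV : IsShapePotential φa φb φL φR V) {φ : ℝ} (hφ : φ ∈ Ioo φa φb) :
    0 < F φa φb V φ := by
  rw [hV.F_eq hφ]
  exact Real.sqrt_pos.2 (div_pos (hV.f_pos hφ) (hV.pos hφ))

theorem F_sq (hV : IsShapePotential φa φb φL φR V) {φ : ℝ} (hφ : φ ∈ Ioo φa φb) :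
    F φa φb V φ ^ 2 = f φa φb φ / V φ := by
  rw [hV.F_eq hφ, Real.sq_sqrt (div_pos (hV.f_pos hφ) (hV.pos hφ)).le]

theorem hasDerivAt_F (hV : IsShapePotential φa φb φL φR V) {φ : ℝ} (hφ : φ ∈ Ioo φa φb) :
    HasDerivAt (F φa φb V) ((deriv (f φa φb) φ / V φ - f φa φb φ * deriv V φ / V φ ^ 2)
      / (2 * F φa φb V φ)) φ := by
  have h1 := hV.f_pos hφ
  have h2 := hV.pos hφ
  have heq : F φa φb V =ᶠ[𝓝 φ] fun φ => √(f φa φb φ / V φ) := by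
    filter_upwards [isOpen_Ioo.mem_nhds hφ] with x hx using hV.F_eq hx
  refine HasDerivAt.congr_of_eventuallyEq ?_ heq
  refine ((((hasDerivAt_f φa φb φ).fun_div (hV.hasDerivAt hφ) h2.ne')).sqrt
    (div_pos h1 h2).ne').congr_deriv ?_
  rw [hV.F_eq hφ]
  congr 1
  field_simp

theorem deriv_W (hV : IsShapePotential φa φb φL φR V) {φ : ℝ} (hφ : φ ∈ Ioo φa φb) :
    deriv (W φa φb V) φ = deriv (f φa φb) φ * V φ + f φa φb φ * deriv V φ :=
  ((hasDerivAt_f φa φb φ).mul (hV.hasDerivAt hφ)).deriv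

theorem mem_collisionManifold_iff (hV : IsShapePotential φa φb φL φR V) {r v φ p : ℝ} :
    ((r, v, φ, F φa φb V φ * p) : State) ∈ collisionManifold φa φb V ↔
      r = 0 ∧ φ ∈ Ioo φa φb ∧ p ^ 2 + v ^ 2 = 2 * V φ := by
  refine and_congr_right fun _ => and_congr_right fun hφ => ?_
  have h1 := hV.f_pos hφ
  have h2 := hV.pos hφ
  rw [mul_pow, hV.F_sq hφ, W]
  have : f φa φb φ / V φ * p ^ 2 / (2 * f φa φb φ) + f φa φb φ / (f φa φb φ * V φ) * (v ^ 2 / 2)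
      = (p ^ 2 + v ^ 2) / (2 * V φ) := by
    field_simp
  rw [this, div_eq_one_iff_eq (by positivity)]

/-- The vector field on the collision manifold, in terms of the scaled shape velocity `p`. -/
theorem field_eq (hV : IsShapePotential φa φb φL φR V) {v φ p : ℝ} (hφ : φ ∈ Ioo φa φb)
    (hp : p ^ 2 + v ^ 2 = 2 * V φ) :
    field φa φb V (-1) (0, v, φ, F φa φb V φ * p) =
      (0, F φa φb V φ * p ^ 2 / 2, F φa φb V φ * p,
        (deriv (f φa φb) φ / V φ - f φa φb φ * deriv V φ / V φ ^ 2) / 2 * p ^ 2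
          + F φa φb V φ ^ 2 * (deriv V φ - v * p / 2)) := by
  have h1 := hV.f_pos hφ
  have h2 := hV.pos hφ
  have hsq : √(W φa φb V φ) = F φa φb V φ * V φ := by
    have : 0 < √(W φa φb V φ) := Real.sqrt_pos.2 (mul_pos h1 h2)
    rw [F, div_mul_eq_mul_div, eq_div_iff this.ne', W, Real.mul_self_sqrt (mul_pos h1 h2).le]
  have hv : v ^ 2 = 2 * V φ - p ^ 2 := by linarith
  simp only [field, zero_mul, mul_zero, hV.deriv_W hφ, hsq, Prod.mk.injEq, true_and]
  constructor
  · rw [hv]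
    ring
  · have e : -(v * (F φa φb V φ * p) / 2) * F φa φb V φ = -(v * p / 2) * F φa φb V φ ^ 2 := by ring
    rw [e, mul_pow, hV.F_sq hφ, zero_sub, hv, W]
    field_simp
    ring

end IsShapePotential

/-! ### Existence of the branch. -/

/-- The profile becomes an orbit once x' = F·x·y is solved. Putting x = H·exp τ gives τ' = F·y, with
coefficient bounded and bounded away from 0; so x → 0 only as s → -∞, and x(0) = H. -/
theorem isV3_of_isBranchProfile (hV : IsShapePotential φa φb φL φR V) {y v : ℝ → ℝ}
    (hP : IsBranchProfile φL ((φa + φb) / 2 - φL) V y v) :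
    IsV3 φa φb φL V (v ((φa + φb) / 2 - φL)) := by
  set H := (φa + φb) / 2 - φL with hH
  have hH0 : 0 < H := sub_pos.2 hV.left_lt
  have hmem : ∀ x ∈ Icc 0 H, φL + x ∈ Ioo φa φb := fun x hx =>
    hV.mem_Ioo_of_mem_Icc ⟨by linarith [hx.1], by linarith [hx.2]⟩
  have hFc : ContinuousOn (F φa φb V) (Ioo φa φb) := fun φ hφ =>
    (hV.hasDerivAt_F hφ).continuousAt.continuousWithinAt
  have hκc : ContinuousOn (fun x => F φa φb V (φL + x) * y x) (Icc 0 H) :=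
    (hFc.comp (by fun_prop) hmem).mul hP.continuous.continuousOn
  have hκ0 : ∀ x ∈ Icc 0 H, 0 < F φa φb V (φL + x) * y x := fun x hx =>
    mul_pos (hV.F_pos (hmem x hx)) (hP.pos x hx)
  obtain ⟨xm, hxm, hmin⟩ := isCompact_Icc.exists_isMinOn (nonempty_Icc.2 hH0.le) hκc
  obtain ⟨xM, -, hmax⟩ := isCompact_Icc.exists_isMaxOn (nonempty_Icc.2 hH0.le) hκc
  -- Cutting t off at 0 defines the coefficient on all of ℝ; only τ ≤ 0 is used.
  set ξ : ℝ → ℝ := fun t => H * Real.exp (min t 0) with hξ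
  have hξmem : ∀ t, ξ t ∈ Icc 0 H := fun t =>
    ⟨by positivity, mul_le_of_le_one_right hH0.le (Real.exp_le_one_iff.2 (min_le_right _ _))⟩
  have hξc : Continuous ξ := by fun_prop
  obtain ⟨τ, hτ0, hτmono, hτd, hτbot⟩ := exists_flow_of_bounds
    (hκc.comp_continuous hξc hξmem) (hκ0 xm hxm) (fun t => hmin (hξmem t))
    (fun t => hmax (hξmem t))
  set x : ℝ → ℝ := fun s => H * Real.exp (τ s) with hx
  have hτle : ∀ s ≤ 0, τ s ≤ 0 := fun s hs => hτ0 ▸ hτmono hs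
  have hξx : ∀ s ≤ 0, ξ (τ s) = x s := fun s hs => by
    simp only [hξ, hx, min_eq_left (hτle s hs)]
  have hxmem : ∀ s ≤ 0, x s ∈ Ioc 0 H := fun s hs =>
    ⟨by positivity, hξx s hs ▸ (hξmem (τ s)).2⟩
  have hxd : ∀ s ≤ 0, HasDerivAt x (F φa φb V (φL + x s) * (x s * y (x s))) s := fun s hs => by
    refine (((hτd s).exp).const_mul H).congr_deriv ?_
    rw [Function.comp_apply, hξx s hs]
    simp only [hx]
    ring
  have hxbot : Tendsto x atBot (𝓝 0) := by
    have := (Real.tendsto_exp_atBot.comp hτbot).const_mul H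
    rwa [mul_zero] at this
  have hxin : ∀ᶠ s in atBot, x s ∈ Icc 0 H := by
    filter_upwards [eventually_le_atBot 0] with s hs using Ioc_subset_Icc_self (hxmem s hs)
  have hx0 : x 0 = H := by simp [hx, hτ0]
  have hL := hV.left_mem
  have h0mem : (0 : ℝ) ∈ Icc 0 H := left_mem_Icc.2 hH0.le
  have hv0 : v 0 = -√(2 * V φL) := by
    have := hP.energy 0 h0mem
    rw [zero_mul, add_zero, sq 0, mul_zero, zero_add] at this
    rw [← this, Real.sqrt_sq_eq_abs, abs_of_neg (hP.neg 0 h0mem), neg_neg]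
  refine ⟨fun s => (0, v (x s), φL + x s, F φa φb V (φL + x s) * (x s * y (x s))), 0,
    ⟨fun s hs => ?_, fun s hs => ?_, ?_, fun s hs hne => ?_, ?_⟩, fun s hs hm => ?_, ?_, ?_⟩
  · have hs0 : s ≤ 0 := hs
    have hxs := hxmem s hs0
    have hxI := Ioc_subset_Icc_self hxs
    have hpd := (hP.hasDerivAt (x s) hxs).comp s (hxd s hs0)
    have hFd := (hV.hasDerivAt_F (hmem _ hxI)).comp s ((hxd s hs0).const_add φL)
    have hvd := (hP.hasDerivWithinAt (x s) hxs).comp s (hxd s hs0).hasDerivWithinAt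
      (fun t (ht : t ≤ 0) => Ioc_subset_Icc_self (hxmem t ht) : MapsTo x (Iic 0) (Icc 0 H))
    rw [hV.field_eq (hmem _ hxI) (hP.energy _ hxI)]
    refine (hasDerivWithinAt_const _ _ _).prodMk ((hvd.congr_deriv ?_).prodMk
      (((hxd s hs0).const_add φL).hasDerivWithinAt.prodMk
        ((hFd.mul hpd).hasDerivWithinAt.congr_deriv ?_)))
    · ring
    · have h1 := (hV.F_pos (hmem _ hxI)).ne'
      have h2 := hxs.1.ne'
      have h3 := (hP.pos _ hxI).ne'
      simp only [Function.comp]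
      field_simp
  · have hxI := Ioc_subset_Icc_self (hxmem s hs)
    exact hV.mem_collisionManifold_iff.2 ⟨rfl, hmem _ hxI, hP.energy _ hxI⟩
  · have hvt : Tendsto (fun s => v (x s)) atBot (𝓝 (-√(2 * V φL))) := by
      rw [← hv0]
      exact (hP.continuousOn 0 h0mem).tendsto.comp (tendsto_nhdsWithin_iff.2 ⟨hxbot, hxin⟩)
    have hφt : Tendsto (fun s => φL + x s) atBot (𝓝 φL) := by
      simpa using hxbot.const_add φL
    have hwt : Tendsto (fun s => F φa φb V (φL + x s) * (x s * y (x s))) atBot (𝓝 0) := by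
      have h1 := (hV.hasDerivAt_F hL).continuousAt.tendsto.comp hφt
      have h2 := hxbot.mul ((hP.continuous.tendsto 0).comp hxbot)
      have h3 := h1.mul h2
      rwa [zero_mul, mul_zero] at h3
    exact tendsto_const_nhds.prodMk_nhds (hvt.prodMk_nhds (hφt.prodMk_nhds hwt))
  · have h1 : φL + x s = φL := congrArg (fun q : State => q.2.2.1) hne
    linarith [(hxmem s hs).1]
  · filter_upwards [eventually_le_atBot 0] with s hs
    have hxs := hxmem s hs
    have hxI := Ioc_subset_Icc_self hxs
    exact mul_nonneg (hV.F_pos (hmem _ hxI)).le (mul_nonneg hxs.1.le (hP.pos _ hxI).le)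
  · have h1 : φL + x s = (φa + φb) / 2 := hm
    have hIic : ∀ {s : ℝ}, s ∈ interior (Iic (0 : ℝ)) → s ≤ 0 := fun hs =>
      mem_Iic.1 (interior_subset hs)
    have h2 : StrictMonoOn x (Iic 0) := by
      refine strictMonoOn_of_hasDerivWithinAt_pos (convex_Iic 0)
        (fun s hs => (hxd s hs).continuousAt.continuousWithinAt)
        (fun s hs => (hxd s (hIic hs)).hasDerivWithinAt) fun s hs => ?_
      have hxs := hxmem s (hIic hs)
      have hxI := Ioc_subset_Icc_self hxs
      exact mul_pos (hV.F_pos (hmem _ hxI)) (mul_pos hxs.1 (hP.pos _ hxI))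
    have h3 := h2 (mem_Iic.2 hs.le) (mem_Iic.2 le_rfl) hs
    rw [hx0] at h3
    linarith
  · change φL + x 0 = _
    rw [hx0, hH]
    ring
  · change v (x 0) = _
    rw [hx0]

/-! ### Uniqueness of the branch. -/

/-- The shape velocity divided by `F`. -/
noncomputable def scaledVelocity (φa φb : ℝ) (V : ℝ → ℝ) (x : State) : ℝ := x.2.2.2 / F φa φb V x.2.2.1

namespace IsGammaPrimeArc

variable {γ : ℝ → State} {s₁ s : ℝ}

theorem shape_mem (hγ : IsGammaPrimeArc φa φb φL V γ s₁) (hs : s ≤ s₁) :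
    (γ s).2.2.1 ∈ Ioo φa φb :=
  (hγ.mem_collision s hs).2.1

theorem eq_mk (hV : IsShapePotential φa φb φL φR V) (hγ : IsGammaPrimeArc φa φb φL V γ s₁)
    (hs : s ≤ s₁) : γ s = (0, (γ s).2.1, (γ s).2.2.1,
      F φa φb V (γ s).2.2.1 * scaledVelocity φa φb V (γ s)) := by
  rw [scaledVelocity, mul_div_cancel₀ _ (hV.F_pos (hγ.shape_mem hs)).ne',
    ← show (γ s).1 = 0 from (hγ.mem_collision s hs).1]

theorem energy (hV : IsShapePotential φa φb φL φR V) (hγ : IsGammaPrimeArc φa φb φL V γ s₁)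
    (hs : s ≤ s₁) :
    scaledVelocity φa φb V (γ s) ^ 2 + (γ s).2.1 ^ 2 = 2 * V (γ s).2.2.1 := by
  have h := hγ.mem_collision s hs
  rw [hγ.eq_mk hV hs] at h
  exact (hV.mem_collisionManifold_iff.1 h).2.2

theorem field_eq (hV : IsShapePotential φa φb φL φR V) (hγ : IsGammaPrimeArc φa φb φL V γ s₁)
    (hs : s ≤ s₁) : field φa φb V (-1) (γ s) =
      (0, F φa φb V (γ s).2.2.1 * scaledVelocity φa φb V (γ s) ^ 2 / 2,
        F φa φb V (γ s).2.2.1 * scaledVelocity φa φb V (γ s),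
        (deriv (f φa φb) (γ s).2.2.1 / V (γ s).2.2.1
            - f φa φb (γ s).2.2.1 * deriv V (γ s).2.2.1 / V (γ s).2.2.1 ^ 2) / 2
              * scaledVelocity φa φb V (γ s) ^ 2
          + F φa φb V (γ s).2.2.1 ^ 2
            * (deriv V (γ s).2.2.1 - (γ s).2.1 * scaledVelocity φa φb V (γ s) / 2)) := by
  conv_lhs => rw [hγ.eq_mk hV hs]
  exact hV.field_eq (hγ.shape_mem hs) (hγ.energy hV hs)

theorem hasDerivWithinAt_snd (hγ : IsGammaPrimeArc φa φb φL V γ s₁) (hs : s ≤ s₁) :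
    HasDerivWithinAt (fun s => (γ s).2) (field φa φb V (-1) (γ s)).2 (Iic s₁) s :=
  (ContinuousLinearMap.snd ℝ ℝ (ℝ × ℝ × ℝ)).hasFDerivAt.comp_hasDerivWithinAt s (hγ.solution s hs)

theorem hasDerivWithinAt_size (hV : IsShapePotential φa φb φL φR V)
    (hγ : IsGammaPrimeArc φa φb φL V γ s₁) (hs : s ≤ s₁) :
    HasDerivWithinAt (fun s => (γ s).2.1)
      (F φa φb V (γ s).2.2.1 * scaledVelocity φa φb V (γ s) ^ 2 / 2) (Iic s₁) s := by
  have h := (ContinuousLinearMap.fst ℝ ℝ (ℝ × ℝ)).hasFDerivAt.comp_hasDerivWithinAt s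
    (hγ.hasDerivWithinAt_snd hs)
  rw [hγ.field_eq hV hs] at h
  exact h

theorem hasDerivWithinAt_snd_snd (hγ : IsGammaPrimeArc φa φb φL V γ s₁) (hs : s ≤ s₁) :
    HasDerivWithinAt (fun s => (γ s).2.2) (field φa φb V (-1) (γ s)).2.2 (Iic s₁) s :=
  (ContinuousLinearMap.snd ℝ ℝ (ℝ × ℝ)).hasFDerivAt.comp_hasDerivWithinAt s
    (hγ.hasDerivWithinAt_snd hs)

theorem hasDerivWithinAt_shape (hV : IsShapePotential φa φb φL φR V)
    (hγ : IsGammaPrimeArc φa φb φL V γ s₁) (hs : s ≤ s₁) :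
    HasDerivWithinAt (fun s => (γ s).2.2.1)
      (F φa φb V (γ s).2.2.1 * scaledVelocity φa φb V (γ s)) (Iic s₁) s := by
  have h := (ContinuousLinearMap.fst ℝ ℝ ℝ).hasFDerivAt.comp_hasDerivWithinAt s
    (hγ.hasDerivWithinAt_snd_snd hs)
  rw [hγ.field_eq hV hs] at h
  exact h

theorem hasDerivWithinAt_scaledVelocity (hV : IsShapePotential φa φb φL φR V)
    (hγ : IsGammaPrimeArc φa φb φL V γ s₁) (hs : s ≤ s₁) :
    HasDerivWithinAt (fun s => scaledVelocity φa φb V (γ s))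
      (F φa φb V (γ s).2.2.1
        * (deriv V (γ s).2.2.1 - (γ s).2.1 * scaledVelocity φa φb V (γ s) / 2)) (Iic s₁) s := by
  have h := (ContinuousLinearMap.snd ℝ ℝ ℝ).hasFDerivAt.comp_hasDerivWithinAt s
    (hγ.hasDerivWithinAt_snd_snd hs)
  rw [hγ.field_eq hV hs] at h
  have hφ := hγ.shape_mem hs
  have hF := (hV.F_pos hφ).ne'
  have hF' := (hV.hasDerivAt_F hφ).comp_hasDerivWithinAt s (hγ.hasDerivWithinAt_shape hV hs)
  refine (h.div hF' hF).congr_deriv ?_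
  have hw : (γ s).2.2.2 = F φa φb V (γ s).2.2.1 * scaledVelocity φa φb V (γ s) := by
    rw [scaledVelocity, mul_div_cancel₀ _ hF]
  simp only [Function.comp, ContinuousLinearMap.coe_snd', hw]
  field_simp
  ring

theorem tendsto_size (hγ : IsGammaPrimeArc φa φb φL V γ s₁) :
    Tendsto (fun s => (γ s).2.1) atBot (𝓝 (-√(2 * V φL))) :=
  ((continuous_fst.comp continuous_snd).tendsto _).comp hγ.tendsto

theorem tendsto_shape (hγ : IsGammaPrimeArc φa φb φL V γ s₁) :
    Tendsto (fun s => (γ s).2.2.1) atBot (𝓝 φL) :=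
  ((continuous_fst.comp (continuous_snd.comp continuous_snd)).tendsto _).comp hγ.tendsto

theorem tendsto_scaledVelocity (hV : IsShapePotential φa φb φL φR V)
    (hγ : IsGammaPrimeArc φa φb φL V γ s₁) :
    Tendsto (fun s => scaledVelocity φa φb V (γ s)) atBot (𝓝 0) := by
  have h1 : Tendsto (fun s => (γ s).2.2.2) atBot (𝓝 0) :=
    ((continuous_snd.comp (continuous_snd.comp continuous_snd)).tendsto _).comp hγ.tendsto
  have h2 := (hV.hasDerivAt_F hV.left_mem).continuousAt.tendsto.comp hγ.tendsto_shape
  have h3 := h1.div h2 (hV.F_pos hV.left_mem).ne'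
  rwa [zero_div] at h3

theorem lt_shape (hV : IsShapePotential φa φb φL φR V) (hγ : IsGammaPrimeArc φa φb φL V γ s₁)
    {s₂ : ℝ} (hs₂ : s₂ ≤ s₁) (hp : ∀ s < s₂, 0 < scaledVelocity φa φb V (γ s)) (hs : s ≤ s₂) :
    φL < (γ s).2.2.1 := by
  have hmono : StrictMonoOn (fun s => (γ s).2.2.1) (Iic s₂) := by
    refine strictMonoOn_of_hasDerivWithinAt_pos
      (f' := fun s => F φa φb V (γ s).2.2.1 * scaledVelocity φa φb V (γ s)) (convex_Iic _)
      (fun t ht => ((hγ.hasDerivWithinAt_shape hV ((mem_Iic.1 ht).trans hs₂)).mono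
        (Iic_subset_Iic.2 hs₂)).continuousWithinAt) (fun t ht => ?_) fun t ht => ?_ <;>
      rw [interior_Iic] at ht
    · rw [interior_Iic]
      exact (hγ.hasDerivWithinAt_shape hV (ht.le.trans hs₂)).mono fun u hu =>
        (mem_Iio.1 hu).le.trans hs₂
    · exact mul_pos (hV.F_pos (hγ.shape_mem (ht.le.trans hs₂))) (hp t ht)
  have h1 : (γ (s - 1)).2.2.1 < (γ s).2.2.1 :=
    hmono (mem_Iic.2 (by linarith)) (mem_Iic.2 hs) (by linarith)
  refine lt_of_le_of_lt (le_of_tendsto hγ.tendsto_shape ?_) h1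
  filter_upwards [eventually_le_atBot (s - 1)] with t ht
  exact hmono.monotoneOn (mem_Iic.2 (by linarith)) (mem_Iic.2 (by linarith)) ht

/-- As functions of φ, both p and the profile q solve an equation whose right side is nonincreasing
in p. So (p - q)² is nonincreasing in s; it tends to 0 at -∞, hence vanishes. Signs are assumed only
for s < s₂, so that the lemma applies at a first failure time. -/
theorem eq_profile (hV : IsShapePotential φa φb φL φR V)
    (hγ : IsGammaPrimeArc φa φb φL V γ s₁) {y v : ℝ → ℝ}
    (hP : IsBranchProfile φL ((φa + φb) / 2 - φL) V y v) {s₂ : ℝ} (hs₂ : s₂ ≤ s₁)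
    (hφ : ∀ s ≤ s₂, (γ s).2.2.1 ≤ (φa + φb) / 2)
    (hp : ∀ s < s₂, 0 < scaledVelocity φa φb V (γ s)) (hv : ∀ s < s₂, (γ s).2.1 < 0) :
    scaledVelocity φa φb V (γ s₂) = ((γ s₂).2.2.1 - φL) * y ((γ s₂).2.2.1 - φL) ∧
      (γ s₂).2.1 = v ((γ s₂).2.2.1 - φL) := by
  set H := (φa + φb) / 2 - φL with hH
  set x : ℝ → ℝ := fun s => (γ s).2.2.1 - φL with hx
  set p : ℝ → ℝ := fun s => scaledVelocity φa φb V (γ s) with hpdef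
  set q : ℝ → ℝ := fun t => t * y t with hq
  have hqc : Continuous q := continuous_id.mul hP.continuous
  have hxmem : ∀ s ≤ s₂, x s ∈ Ioc 0 H := fun s hs =>
    ⟨sub_pos.2 (hγ.lt_shape hV hs₂ hp hs), sub_le_sub_right (hφ s hs) _⟩
  have hq0 : ∀ s ≤ s₂, 0 < q (x s) := fun s hs =>
    mul_pos (hxmem s hs).1 (hP.pos _ (Ioc_subset_Icc_self (hxmem s hs)))
  have hxeq : ∀ s, φL + x s = (γ s).2.2.1 := fun s => add_sub_cancel _ _
  have henergy : ∀ s ≤ s₂, p s ^ 2 + (γ s).2.1 ^ 2 = q (x s) ^ 2 + v (x s) ^ 2 := fun s hs => by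
    rw [hP.energy _ (Ioc_subset_Icc_self (hxmem s hs)), hxeq]
    exact hγ.energy hV (hs.trans hs₂)
  have hxd : ∀ s ≤ s₂, HasDerivWithinAt x (F φa φb V (γ s).2.2.1 * p s) (Iic s₂) s :=
    fun s hs => ((hγ.hasDerivWithinAt_shape hV (hs.trans hs₂)).sub_const φL).mono
      (Iic_subset_Iic.2 hs₂)
  have hpd := fun s (hs : s ≤ s₂) =>
    (hγ.hasDerivWithinAt_scaledVelocity hV (hs.trans hs₂)).mono (Iic_subset_Iic.2 hs₂)
  have hanti : AntitoneOn (fun s => (p s - q (x s)) ^ 2) (Iic s₂) := by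
    have hd : ∀ s ≤ s₂, HasDerivWithinAt (fun s => (p s - q (x s)) ^ 2)
        (2 * (p s - q (x s)) * (F φa φb V (γ s).2.2.1
            * (deriv V (γ s).2.2.1 - (γ s).2.1 * p s / 2)
          - (deriv V (γ s).2.2.1 / q (x s) - v (x s) / 2)
            * (F φa φb V (γ s).2.2.1 * p s))) (Iic s₂) s := by
      intro s hs
      have h1 := (hP.hasDerivAt _ (hxmem s hs)).comp_hasDerivWithinAt s (hxd s hs)
      refine (((hpd s hs).sub h1).pow 2).congr_deriv ?_
      rw [hxeq]
      simp [hq, hpdef]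
    refine antitoneOn_of_hasDerivWithinAt_nonpos (convex_Iic _)
      (fun s hs => (hd s hs).continuousWithinAt)
      (fun s hs => (hd s (mem_Iic.1 (interior_subset hs))).mono interior_subset) fun s hs => ?_
    rw [interior_Iic] at hs
    have hs' : s ≤ s₂ := hs.le
    have hqs := hq0 s hs'
    have hps := hp s hs
    have hvs := hv s hs
    have hvx := hP.neg _ (Ioc_subset_Icc_self (hxmem s hs'))
    have hF := hV.F_pos (hγ.shape_mem (hs'.trans hs₂))
    have hV' : 0 ≤ deriv V (γ s).2.2.1 :=
      hV.deriv_nonneg ⟨(hγ.lt_shape hV hs₂ hp hs').le, hφ s hs'⟩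
    have he := henergy s hs'
    change 0 < p s at hps
    -- Equal energies and negative size velocities: p - q and the difference of the size velocities
    -- have the same sign.
    have key : 0 ≤ ((γ s).2.1 - v (x s)) * (p s - q (x s)) := by
      have h1 : ((γ s).2.1 - v (x s)) * (p s - q (x s)) * -((γ s).2.1 + v (x s))
          = (p s - q (x s)) ^ 2 * (p s + q (x s)) := by linear_combination (q (x s) - p s) * he
      have h2 : 0 ≤ (p s - q (x s)) ^ 2 * (p s + q (x s)) := by positivity
      rw [← h1] at h2
      exact nonneg_of_mul_nonneg_left h2 (by linarith)
    have e : 2 * (p s - q (x s)) * (F φa φb V (γ s).2.2.1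
            * (deriv V (γ s).2.2.1 - (γ s).2.1 * p s / 2)
          - (deriv V (γ s).2.2.1 / q (x s) - v (x s) / 2)
            * (F φa φb V (γ s).2.2.1 * p s))
        = -(F φa φb V (γ s).2.2.1 * (2 * (deriv V (γ s).2.2.1 * (p s - q (x s)) ^ 2 / q (x s))
          + p s * (((γ s).2.1 - v (x s)) * (p s - q (x s))))) := by
      field_simp
      ring
    rw [e, neg_nonpos]
    positivity
  have hlim : Tendsto (fun s => (p s - q (x s)) ^ 2) atBot (𝓝 0) := by
    have h1 : Tendsto x atBot (𝓝 0) := by simpa using hγ.tendsto_shape.sub_const φL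
    have h2 := (hqc.tendsto 0).comp h1
    have h3 := ((hγ.tendsto_scaledVelocity hV).sub h2).pow 2
    simpa [hq] using h3
  have hle : (p s₂ - q (x s₂)) ^ 2 ≤ 0 := by
    refine ge_of_tendsto hlim ?_
    filter_upwards [eventually_le_atBot s₂] with t ht
    exact hanti (mem_Iic.2 ht) (mem_Iic.2 le_rfl) ht
  have heq : p s₂ = q (x s₂) := sub_eq_zero.1 (pow_eq_zero_iff two_ne_zero |>.1
    (le_antisymm hle (sq_nonneg _)))
  refine ⟨heq, ?_⟩
  -- At s₂ itself only v ≤ 0 survives, by continuity; it still selects the negative root.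
  have hvle : (γ s₂).2.1 ≤ 0 := by
    have hsub : Iio s₂ ⊆ Iic s₁ := fun u hu => (mem_Iio.1 hu).le.trans hs₂
    have hc := ((hγ.hasDerivWithinAt_size hV hs₂).continuousWithinAt.mono hsub).tendsto
    refine le_of_tendsto hc ?_
    filter_upwards [self_mem_nhdsWithin] with t ht using (hv t ht).le
  have he := henergy s₂ le_rfl
  rw [heq] at he
  have hvx := hP.neg _ (Ioc_subset_Icc_self (hxmem s₂ le_rfl))
  rcases sq_eq_sq_iff_eq_or_eq_neg.1 (add_left_cancel he) with h | h
  · exact h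
  · linarith

theorem shape_le (hV : IsShapePotential φa φb φL φR V) (hγ : IsGammaPrimeArc φa φb φL V γ s₁)
    (hne : ∀ s < s₁, (γ s).2.2.1 ≠ (φa + φb) / 2) (heq : (γ s₁).2.2.1 = (φa + φb) / 2)
    (hs : s ≤ s₁) : (γ s).2.2.1 ≤ (φa + φb) / 2 := by
  rcases hs.eq_or_lt with rfl | hlt
  · exact heq.le
  by_contra! hcon
  obtain ⟨t, ht, hts⟩ := ((hγ.tendsto_shape.eventually_lt_const hV.left_lt).and
    (eventually_le_atBot s)).exists
  have hc : ContinuousOn (fun s => (γ s).2.2.1) (Icc t s) := fun u hu =>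
    (hγ.hasDerivWithinAt_shape hV (hu.2.trans hs)).continuousWithinAt.mono
      fun w hw => hw.2.trans hs
  obtain ⟨u, hu, hu'⟩ := intermediate_value_Icc hts hc ⟨ht.le, hcon.le⟩
  exact hne u (hu.2.trans_lt hlt) hu'

/-- Where w ≥ 0, both φ and v are nondecreasing from their equilibrium values. If p = 0, then v² =
2V(φ) ≥ 2V(φL), while -√(2V(φL)) ≤ v < 0; strict monotonicity of V forces the equilibrium itself. -/
theorem eventually_pos (hV : IsShapePotential φa φb φL φR V)
    (hγ : IsGammaPrimeArc φa φb φL V γ s₁)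
    (hφ : ∀ s ≤ s₁, (γ s).2.2.1 ≤ (φa + φb) / 2) :
    ∃ s₀ ≤ s₁, ∀ s ≤ s₀, 0 < scaledVelocity φa φb V (γ s) ∧ (γ s).2.1 < 0 := by
  have hVL := hV.pos hV.left_mem
  have hneg : -√(2 * V φL) < 0 := neg_lt_zero.2 (Real.sqrt_pos.2 (by linarith))
  obtain ⟨s₀, hs₀⟩ := eventually_atBot.1 ((hγ.initially.and
    (hγ.tendsto_size.eventually_lt_const hneg)).and (eventually_le_atBot s₁))
  have hs01 : s₀ ≤ s₁ := (hs₀ s₀ le_rfl).2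
  refine ⟨s₀, hs01, fun s hs => ?_⟩
  have hs1 := hs.trans hs01
  have hp0 : ∀ t ≤ s₀, 0 ≤ scaledVelocity φa φb V (γ t) := fun t ht =>
    div_nonneg (hs₀ t ht).1.1 (hV.F_pos (hγ.shape_mem (ht.trans hs01))).le
  refine ⟨lt_of_le_of_ne (hp0 s hs) fun h0 => hγ.ne_equilibrium s hs1 ?_, (hs₀ s hs).1.2⟩
  have hIic : ∀ {t}, t ∈ interior (Iic s₀) → t ≤ s₀ := fun ht => mem_Iic.1 (interior_subset ht)
  have hsub : Iic s₀ ⊆ Iic s₁ := Iic_subset_Iic.2 hs01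
  have hφmono : MonotoneOn (fun s => (γ s).2.2.1) (Iic s₀) :=
    monotoneOn_of_hasDerivWithinAt_nonneg (convex_Iic _)
      (fun t ht => (hγ.hasDerivWithinAt_shape hV (hsub ht)).continuousWithinAt.mono hsub)
      (fun t ht => (hγ.hasDerivWithinAt_shape hV (hsub (hIic ht))).mono
        (interior_subset.trans hsub))
      fun t ht => mul_nonneg (hV.F_pos (hγ.shape_mem (hsub (hIic ht)))).le (hp0 t (hIic ht))
  have hvmono : MonotoneOn (fun s => (γ s).2.1) (Iic s₀) :=
    monotoneOn_of_hasDerivWithinAt_nonneg (convex_Iic _)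
      (fun t ht => (hγ.hasDerivWithinAt_size hV (hsub ht)).continuousWithinAt.mono hsub)
      (fun t ht => (hγ.hasDerivWithinAt_size hV (hsub (hIic ht))).mono
        (interior_subset.trans hsub))
      fun t ht => div_nonneg (mul_nonneg (hV.F_pos (hγ.shape_mem (hsub (hIic ht)))).le
        (sq_nonneg _)) zero_le_two
  have hφL : φL ≤ (γ s).2.2.1 := by
    refine le_of_tendsto hγ.tendsto_shape ?_
    filter_upwards [eventually_le_atBot s] with t ht
    exact hφmono (mem_Iic.2 (ht.trans hs)) (mem_Iic.2 hs) ht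
  have hvL : -√(2 * V φL) ≤ (γ s).2.1 := by
    refine le_of_tendsto hγ.tendsto_size ?_
    filter_upwards [eventually_le_atBot s] with t ht
    exact hvmono (mem_Iic.2 (ht.trans hs)) (mem_Iic.2 hs) ht
  have he := hγ.energy hV hs1
  rw [← h0] at he
  have hvneg := (hs₀ s hs).1.2
  have hsq : √(2 * V φL) ^ 2 = 2 * V φL := Real.sq_sqrt (by linarith)
  have hVle : V (γ s).2.2.1 ≤ V φL := by
    have := pow_le_pow_left₀ (neg_nonneg.2 hvneg.le) (neg_le.1 hvL) 2
    rw [hsq] at this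
    linarith
  have hmem : (γ s).2.2.1 ∈ Icc φL ((φa + φb) / 2) := ⟨hφL, hφ s hs1⟩
  have hφeq : (γ s).2.2.1 = φL :=
    le_antisymm ((hV.strictMonoOn.le_iff_le hmem (left_mem_Icc.2 hV.left_lt.le)).1 hVle) hφL
  have hveq : (γ s).2.1 = -√(2 * V φL) := by
    have : (γ s).2.1 ^ 2 = 2 * V φL := by rw [hφeq] at he; linarith
    rw [← this, Real.sqrt_sq_eq_abs, abs_of_neg hvneg, neg_neg]
  rw [hγ.eq_mk hV hs1, ← h0, hφeq, hveq, mul_zero, lowerLagrange]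

/-- At the first time a sign fails, `eq_profile` still identifies the orbit with the profile, whose
signs are strict. -/
theorem pos_and_neg (hV : IsShapePotential φa φb φL φR V)
    (hγ : IsGammaPrimeArc φa φb φL V γ s₁) {y v : ℝ → ℝ}
    (hP : IsBranchProfile φL ((φa + φb) / 2 - φL) V y v)
    (hφ : ∀ s ≤ s₁, (γ s).2.2.1 ≤ (φa + φb) / 2) (hs : s ≤ s₁) :
    0 < scaledVelocity φa φb V (γ s) ∧ (γ s).2.1 < 0 := by
  obtain ⟨s₀, hs01, hs₀⟩ := hγ.eventually_pos hV hφ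
  have hpc : ContinuousOn (fun s => scaledVelocity φa φb V (γ s)) (Icc s₀ s₁) := fun t ht =>
    (hγ.hasDerivWithinAt_scaledVelocity hV ht.2).continuousWithinAt.mono Icc_subset_Iic_self
  have hvc : ContinuousOn (fun s => (γ s).2.1) (Icc s₀ s₁) := fun t ht =>
    (hγ.hasDerivWithinAt_size hV ht.2).continuousWithinAt.mono Icc_subset_Iic_self
  set B := {t ∈ Icc s₀ s₁ | min (scaledVelocity φa φb V (γ t)) (-(γ t).2.1) ≤ 0} with hB
  have hgood : ∀ t ≤ s₁, t ∉ B → 0 < scaledVelocity φa φb V (γ t) ∧ (γ t).2.1 < 0 := by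
    intro t ht htB
    rcases le_total t s₀ with h | h
    · exact hs₀ t h
    · have : 0 < min (scaledVelocity φa φb V (γ t)) (-(γ t).2.1) := by
        by_contra! hcon
        exact htB ⟨⟨h, ht⟩, hcon⟩
      rw [lt_min_iff, neg_pos] at this
      exact this
  rcases B.eq_empty_or_nonempty with hne | hne
  · exact hgood s hs (hne ▸ notMem_empty s)
  exfalso
  have hBc : IsCompact B :=
    (isCompact_Icc.of_isClosed_subset ((continuous_min.comp_continuousOn
      (hpc.prodMk hvc.neg)).preimage_isClosed_of_isClosed
      isClosed_Icc isClosed_Iic) inter_subset_left)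
  have hmem := hBc.sInf_mem hne
  have hlt : ∀ t < sInf B, 0 < scaledVelocity φa φb V (γ t) ∧ (γ t).2.1 < 0 := fun t ht =>
    hgood t (ht.le.trans hmem.1.2) (notMem_of_lt_csInf ht hBc.bddBelow)
  obtain ⟨h1, h2⟩ := hγ.eq_profile hV hP hmem.1.2 (fun t ht => hφ t (ht.trans hmem.1.2))
    (fun t ht => (hlt t ht).1) fun t ht => (hlt t ht).2
  have hx : (γ (sInf B)).2.2.1 - φL ∈ Ioc 0 ((φa + φb) / 2 - φL) :=
    ⟨sub_pos.2 (hγ.lt_shape hV hmem.1.2 (fun t ht => (hlt t ht).1) le_rfl),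
      sub_le_sub_right (hφ _ hmem.1.2) _⟩
  have hxI := Ioc_subset_Icc_self hx
  refine hmem.2.not_gt (lt_min ?_ ?_)
  · rw [h1]
    exact mul_pos hx.1 (hP.pos _ hxI)
  · rw [h2, neg_pos]
    exact hP.neg _ hxI

end IsGammaPrimeArc

theorem eq_of_isV3 (hV : IsShapePotential φa φb φL φR V) {y v : ℝ → ℝ}
    (hP : IsBranchProfile φL ((φa + φb) / 2 - φL) V y v) {v₃ : ℝ}
    (h : IsV3 φa φb φL V v₃) : v₃ = v ((φa + φb) / 2 - φL) := by
  obtain ⟨γ, s₁, hγ, hne, heq, rfl⟩ := h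
  have hφ := fun s (hs : s ≤ s₁) => hγ.shape_le hV hne heq hs
  rw [← heq]
  exact (hγ.eq_profile hV hP le_rfl hφ (fun s hs => (hγ.pos_and_neg hV hP hφ hs.le).1)
    fun s hs => (hγ.pos_and_neg hV hP hφ hs.le).2).2

end Devaney
theorem mainTheorem10 (φa φb φL φR : ℝ) (V : ℝ → ℝ)
    (hV : Devaney.IsShapePotential φa φb φL φR V)
    (hN2 : V φR > Real.sin ((φR - (φa + φb) / 2) / 2) ^ 2 * V ((φa + φb) / 2)) :
    (∃! v₃ : ℝ, Devaney.IsV3 φa φb φL V v₃) ∧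
      ∀ v₃ : ℝ, Devaney.IsV3 φa φb φL V v₃ → v₃ < 0 := by
  obtain ⟨y, v, hP⟩ := hV.exists_branch_profile hN2
  refine ⟨⟨_, Devaney.isV3_of_isBranchProfile hV hP, fun v₃ h => Devaney.eq_of_isV3 hV hP h⟩,
    fun v₃ h => ?_⟩
  rw [Devaney.eq_of_isV3 hV hP h]
  exact hP.neg _ (right_mem_Icc.2 (sub_pos.2 hV.left_lt).le)
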